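/- For real $x\ge 1$ let $$N_{2,3,5,7}(x)=\#\{(p,q,l,f)\in\mathbb{N}_0^4 : 2^p3^q5^l7^f\le x\},$$ let $S_{2,3,5,7}=\{2^p3^q5^l7^f : p,q,l,f\in\mathbb{N}_0\}$ and let $\chi_{S_{2,3,5,7}}$ be its characteristic function. Let $B_1^*(\{t\})=\{t\}-\frac12$ if $t\notin\mathbb{Z}$ and $B_1^*(\{t\})=0$ if $t\in\mathbb{Z}$, where $\{t\}$ is the fractional part. Put $\mathcal P=\{2,3,5,7\}$, $L=\log x$ and $\ell_p=\log p$; the letters $a,b,c,d$ below denote elements of $\mathcal P$. For real $R>0$ and distinct $a,b,c,d\in\mathcal P$ define the partial sums $$P_{a,b}(R)=\sum_{k=1}^{\lfloor R\ell_a\rfloor}\frac{\cos\left(2\pi k\frac{L-\frac12\ell_b}{\ell_a}\right)}{k\sin\left(\frac{\pi k\ell_b}{\ell_a}\right)}+\sum_{k=1}^{\lfloor R\ell_b\rfloor}\frac{\cos\left(2\pi k\frac{L-\frac12\ell_a}{\ell_b}\right)}{k\sin\left(\frac{\pi k\ell_a}{\ell_b}\right)},$$ $$U_{a;b,c}(R)=\sum_{k=1}^{\lfloor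 R\ell_a\rfloor}\frac{\sin\left(2\pi k\frac{L+\frac12\ell_b-\frac12\ell_c}{\ell_a}\right)+\sin\left(2\pi k\frac{L-\frac12\ell_b+\frac12\ell_c}{\ell_a}\right)}{k\sin\left(\frac{\pi k\ell_b}{\ell_a}\right)\sin\left(\frac{\pi k\ell_c}{\ell_a}\right)},$$ $$V_{a;b,c,d}(R)=\sum_{k=1}^{\lfloor R\ell_a\rfloor}\frac{\cos\left(\frac{\pi k\ell_b}{\ell_a}\right)\cos\left(\frac{\pi k\ell_c}{\ell_a}\right)\cos\left(\frac{\pi k\ell_d}{\ell_a}\right)\cos\left(2\pi k\frac{L}{\ell_a}\right)}{k\sin\left(\frac{\pi k\ell_b}{\ell_a}\right)\sin\left(\frac{\pi k\ell_c}{\ell_a}\right)\sin\left(\frac{\pi k\ell_d}{\ell_a}\right)}.$$ Say that $F(R)\to l$ as $R\to\infty$ in the appropriate manner if, for every $\delta>0$, $F(R)\to l$ as $R\to\infty$ through those real $R$ for which each of $R\ell_2,R\ell_3,R\ell_5,R\ell_7$ has distance at least $\delta$ from the nearest integer. For some $\delta>0$ such $R$ are arbitrarily large (so these limits are unique). Then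 for every real $x\ge1$ the following limits, taken as $R\to\infty$ in the appropriate manner, exist and are finite: $\mathbf P_{a,b}=\lim P_{a,b}(R)$ for each pair $a<b$ in $\mathcal P$; $\mathbf T_{a,b,c}=\lim\bigl(U_{a;b,c}(R)+U_{b;a,c}(R)+U_{c;a,b}(R)\bigr)$ for each triple $a<b<c$ in $\mathcal P$; and $\mathbf Q=\lim\bigl(V_{2;3,5,7}(R)+V_{3;2,5,7}(R)+V_{5;2,3,7}(R)+V_{7;2,3,5}(R)\bigr)$. Moreover $$\begin{aligned} N_{2,3,5,7}(x)={}&\frac{L^4}{24\,\ell_2\ell_3\ell_5\ell_7}+\frac{L^3}{12}\sum_{a<b<c}\frac1{\ell_a\ell_b\ell_c}+\frac{L^2}{24}\sum_{a}\frac{\ell_a}{\prod_{q\ne a}\ell_q}+\frac{L^2}{8}\sum_{a<b}\frac1{\ell_a\ell_b}\\ &+\frac L8\sum_a\frac1{\ell_a}+\frac L{24}\sum_a\ \sum_{\substack{b<c\\ b,c\ne a}}\frac{\ell_a}{\ell_b\ell_c}+\frac1{16}+\frac1{48}\sum_{a\ne b}\frac{\ell_a}{\ell_b}\\ &+\frac1{144}\sum_{a<b}\frac{\ell_a\ell_b}{\prod_{q\ne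 a,b}\ell_q}-\frac1{720}\sum_a\frac{\ell_a^3}{\prod_{q\neq a}\ell_q}-\frac78\sum_{a}B_1^*\left(\left\{\frac{L}{\ell_a}\right\}\right)\\ &-\frac1{8\pi}\sum_{a<b}\mathbf P_{a,b}-\frac1{16\pi}\sum_{a<b<c}\mathbf T_{a,b,c}+\frac1{8\pi}\mathbf Q+\frac12\chi_{S_{2,3,5,7}}(x), \end{aligned}$$ where all sums and products run over elements of $\mathcal P$. -/

import Mathlib

open Filter Topology

/-- The number `N_{2,3,5,7}(x)` of quadruples of exponents `(p, q, l, f)`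
with `2^p * 3^q * 5^l * 7^f ≤ x`. -/
noncomputable def sevenSmoothCount (x : ℝ) : ℕ :=
  Set.ncard {e : ℕ × ℕ × ℕ × ℕ |
    (2 : ℝ) ^ e.1 * 3 ^ e.2.1 * 5 ^ e.2.2.1 * 7 ^ e.2.2.2 ≤ x}

/-- The set `S_{2,3,5,7}` of `7`-smooth numbers, as a set of real numbers. -/
def sevenSmoothSet : Set ℝ :=
  {y | ∃ p q l f : ℕ, y = (2 : ℝ) ^ p * 3 ^ q * 5 ^ l * 7 ^ f}

/-- The characteristic function of the set of `7`-smooth numbers. -/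
noncomputable def sevenSmoothChar (x : ℝ) : ℝ :=
  sevenSmoothSet.indicator (fun _ => (1 : ℝ)) x

open scoped Classical in
/-- `bernoulliStar t` is `B₁*({t})`: it is `{t} - 1/2` if `t` is not an integer, and `0` if it is. -/
noncomputable def bernoulliStar (t : ℝ) : ℝ :=
  if ∃ n : ℤ, (n : ℝ) = t then 0 else Int.fract t - 1 / 2

/-- The polynomial part of the formula, in `L = log x`, where `A, B, C, D` are the logarithms
of the four bases. -/
noncomputable def polyPart (A B C D L : ℝ) : ℝ :=
  L ^ 4 / (24 * A * B * C * D)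
    + L ^ 3 / (12 * A * B * C) + L ^ 3 / (12 * A * B * D)
    + L ^ 3 / (12 * A * C * D) + L ^ 3 / (12 * B * C * D)
    + A * L ^ 2 / (24 * B * C * D) + B * L ^ 2 / (24 * A * C * D)
    + C * L ^ 2 / (24 * A * B * D) + D * L ^ 2 / (24 * A * B * C)
    + L ^ 2 / (8 * A * B) + L ^ 2 / (8 * A * C) + L ^ 2 / (8 * A * D)
    + L ^ 2 / (8 * B * C) + L ^ 2 / (8 * B * D) + L ^ 2 / (8 * C * D)
    + L / (8 * A) + L / (8 * B) + L / (8 * C) + L / (8 * D)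
    + A * L / (24 * B * C) + A * L / (24 * B * D) + A * L / (24 * C * D)
    + B * L / (24 * A * C) + B * L / (24 * A * D) + B * L / (24 * C * D)
    + C * L / (24 * A * B) + C * L / (24 * A * D) + C * L / (24 * B * D)
    + D * L / (24 * A * B) + D * L / (24 * A * C) + D * L / (24 * B * C)
    + 1 / 16
    + A / (48 * B) + A / (48 * C) + A / (48 * D)
    + B / (48 * A) + B / (48 * C) + B / (48 * D)
    + C / (48 * A) + C / (48 * B) + C / (48 * D)
    + D / (48 * A) + D / (48 * B) + D / (48 * C)
    + A * B / (144 * C * D) + A * C / (144 * B * D) + A * D / (144 * B * C)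
    + B * C / (144 * A * D) + B * D / (144 * A * C) + C * D / (144 * A * B)
    - A ^ 3 / (720 * B * C * D) - B ^ 3 / (720 * A * C * D)
    - C ^ 3 / (720 * A * B * D) - D ^ 3 / (720 * A * B * C)

/-- The partial sum with parameter `R` of the series attached to the pair `a, b`:
`k` runs up to `⌊R log a⌋` in the terms with base `a` and up to `⌊R log b⌋` in those with base `b`. -/
noncomputable def pairSum (a b x R : ℝ) : ℝ :=
  (∑ k ∈ Finset.Icc 1 ⌊R * Real.log a⌋₊,
      Real.cos (2 * Real.pi * k * ((Real.log x - 1 / 2 * Real.log b) / Real.log a))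
        / (k * Real.sin (Real.pi * k * Real.log b / Real.log a)))
  + ∑ k ∈ Finset.Icc 1 ⌊R * Real.log b⌋₊,
      Real.cos (2 * Real.pi * k * ((Real.log x - 1 / 2 * Real.log a) / Real.log b))
        / (k * Real.sin (Real.pi * k * Real.log a / Real.log b))

/-- The partial sum with parameter `R` of the sine series with base `a` attached to `b, c`. -/
noncomputable def sineSum (a b c x R : ℝ) : ℝ :=
  ∑ k ∈ Finset.Icc 1 ⌊R * Real.log a⌋₊,
    (Real.sin (2 * Real.pi * k *
          ((Real.log x + 1 / 2 * Real.log b - 1 / 2 * Real.log c) / Real.log a))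
        / (k * Real.sin (Real.pi * k * Real.log b / Real.log a)
            * Real.sin (Real.pi * k * Real.log c / Real.log a))
      + Real.sin (2 * Real.pi * k *
          ((Real.log x - 1 / 2 * Real.log b + 1 / 2 * Real.log c) / Real.log a))
        / (k * Real.sin (Real.pi * k * Real.log b / Real.log a)
            * Real.sin (Real.pi * k * Real.log c / Real.log a)))

/-- The partial sum with parameter `R` of the cosine series with base `a` attached to `b, c, d`. -/
noncomputable def cosineSum (a b c d x R : ℝ) : ℝ :=
  ∑ k ∈ Finset.Icc 1 ⌊R * Real.log a⌋₊,
    Real.cos (Real.pi * k * Real.log b / Real.log a)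
        * Real.cos (Real.pi * k * Real.log c / Real.log a)
        * Real.cos (Real.pi * k * Real.log d / Real.log a)
        * Real.cos (2 * Real.pi * k * (Real.log x / Real.log a))
      / (k * Real.sin (Real.pi * k * Real.log b / Real.log a)
          * Real.sin (Real.pi * k * Real.log c / Real.log a)
          * Real.sin (Real.pi * k * Real.log d / Real.log a))

/-- `R → ∞` through the real numbers such that each of `R log 2`, `R log 3`, `R log 5`, `R log 7`
has distance at least `δ` from the integers, that is, such that none of the four cut-off points
`R log p` is close to a jump of its partial sum. -/
noncomputable def admissible (δ : ℝ) : Filter ℝ :=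
  atTop ⊓ 𝓟 {R : ℝ | ∀ p ∈ ({2, 3, 5, 7} : Set ℝ), ∀ n : ℤ, δ ≤ |R * Real.log p - n|}

/-- `F R` tends to `l` when `R → ∞` in the appropriate manner: for every `δ > 0`, along all `R`
that keep the cut-off points at distance at least `δ` from the integers. -/
def AppropriateLimit (F : ℝ → ℝ) (l : ℝ) : Prop :=
  ∀ δ : ℝ, 0 < δ → Tendsto F (admissible δ) (𝓝 l)

/-!
Put `A = {log 2, log 3, log 5, log 7}` and `L = log x`. The weighted count of the combinations of
`A` with natural coefficients, in which those equal to `L` have weight `1 / 2`, is an inverse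
Laplace transform of `1 / (s * ∏ a ∈ A, (1 - exp (-a * s)))`. Its kernel
`exp (L * s) / (s * ∏ a ∈ A, (1 - exp (-a * s)))` has a pole at `0`, whose residue is a polynomial
in `L` with Bernoulli numbers as coefficients, and poles at `2 * π * I * k / a`, which are simple
because the logarithms are pairwise incommensurable.

For `-∑ a ∈ A, a < L < 0` the kernel decays on both sides, and its integral over the boundary of
a rectangle of height `2 * π * R` tends to `0` when `R → ∞` stays away from the poles; hence so does
the sum of the enclosed residues. Removing `b` from `A` subtracts from the residues at `L` those at
`L - b`, which is also the recursion of the weighted count. Hence the residues sum to the weighted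
count for all `L > -∑ a ∈ A, a`. No estimate of the small denominators is needed.

Finally `1 / (1 - exp (-2 * I * φ)) = (1 - I * cot φ) / 2` expands the residues at
`2 * π * I * k / a` into the terms of the saw, pair, sine and cosine series. Applied to the subsets
of `A` with one, two, three and four elements, this yields in turn the convergence of each kind of
series and, at last, the formula.
-/

open Complex (I)
open Polynomial (X)
open scoped Polynomial PowerSeries Real

section RectangleIntegrals

/-- The integral of `f` along the boundary of the rectangle `[-U, U] × [-T, T]`, traversed
counterclockwise. -/
noncomputable def rectInt (f : ℂ → ℂ) (U T : ℝ) : ℂ :=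
  (∫ x : ℝ in (-U)..U, f (x + ((-T : ℝ) : ℂ) * I))
    - (∫ x : ℝ in (-U)..U, f (x + (T : ℂ) * I))
    + I * (∫ y : ℝ in (-T)..T, f (U + y * I))
    - I * (∫ y : ℝ in (-T)..T, f (((-U : ℝ) : ℂ) + y * I))

/-- The boundary of the rectangle `[-U, U] × [-T, T]`, over which `rectInt` integrates. -/
def rectBoundary (U T : ℝ) : Set ℂ :=
  {s | |s.re| ≤ U ∧ |s.im| ≤ T ∧ (|s.re| = U ∨ |s.im| = T)}

variable {U T : ℝ} {f g F : ℂ → ℂ} {p : ℂ}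

lemma horizontal_mem_rectBoundary (hU : 0 ≤ U) {t x : ℝ} (ht : |t| = T)
    (hx : x ∈ Set.uIcc (-U) U) : (x : ℂ) + t * I ∈ rectBoundary U T := by
  rw [Set.uIcc_of_le (by linarith)] at hx
  simpa [rectBoundary, ht] using abs_le.2 hx

lemma vertical_mem_rectBoundary (hT : 0 ≤ T) {u y : ℝ} (hu : |u| = U)
    (hy : y ∈ Set.uIcc (-T) T) : (u : ℂ) + y * I ∈ rectBoundary U T := by
  rw [Set.uIcc_of_le (by linarith)] at hy
  simpa [rectBoundary, hu] using abs_le.2 hy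

lemma intervalIntegrable_horizontal (hU : 0 ≤ U) (hf : ContinuousOn f (rectBoundary U T))
    {t : ℝ} (ht : |t| = T) :
    IntervalIntegrable (fun x : ℝ => f (x + t * I)) MeasureTheory.volume (-U) U :=
  (hf.comp (by fun_prop) fun _ => horizontal_mem_rectBoundary hU ht).intervalIntegrable

lemma intervalIntegrable_vertical (hT : 0 ≤ T) (hf : ContinuousOn f (rectBoundary U T))
    {u : ℝ} (hu : |u| = U) :
    IntervalIntegrable (fun y : ℝ => f (u + y * I)) MeasureTheory.volume (-T) T :=
  (hf.comp (by fun_prop) fun _ => vertical_mem_rectBoundary hT hu).intervalIntegrable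

lemma rectInt_congr (hU : 0 ≤ U) (hT : 0 ≤ T) (h : Set.EqOn f g (rectBoundary U T)) :
    rectInt f U T = rectInt g U T := by
  have hor {t : ℝ} (ht : |t| = T) := intervalIntegral.integral_congr (μ := MeasureTheory.volume)
    fun x hx => h (horizontal_mem_rectBoundary hU ht hx)
  have ver {u : ℝ} (hu : |u| = U) := intervalIntegral.integral_congr (μ := MeasureTheory.volume)
    fun y hy => h (vertical_mem_rectBoundary hT hu hy)
  rw [rectInt, rectInt, hor (by rwa [abs_neg, abs_of_nonneg]), hor (abs_of_nonneg hT),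
    ver (abs_of_nonneg hU), ver (by rwa [abs_neg, abs_of_nonneg])]

lemma rectInt_add (hU : 0 ≤ U) (hT : 0 ≤ T) (hf : ContinuousOn f (rectBoundary U T))
    (hg : ContinuousOn g (rectBoundary U T)) :
    rectInt (fun s => f s + g s) U T = rectInt f U T + rectInt g U T := by
  have hor {t : ℝ} (ht : |t| = T) := intervalIntegral.integral_add
    (intervalIntegrable_horizontal hU hf ht) (intervalIntegrable_horizontal hU hg ht)
  have ver {u : ℝ} (hu : |u| = U) := intervalIntegral.integral_add
    (intervalIntegrable_vertical hT hf hu) (intervalIntegrable_vertical hT hg hu)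
  rw [rectInt, hor (by rwa [abs_neg, abs_of_nonneg]), hor (abs_of_nonneg hT),
    ver (abs_of_nonneg hU), ver (by rwa [abs_neg, abs_of_nonneg]), rectInt, rectInt]
  ring

lemma rectInt_const_mul (c : ℂ) (f : ℂ → ℂ) :
    rectInt (fun s => c * f s) U T = c * rectInt f U T := by
  simp only [rectInt, intervalIntegral.integral_const_mul]
  ring

lemma rectInt_sum {κ : Type*} (S : Finset κ) {f : κ → ℂ → ℂ} (hU : 0 ≤ U) (hT : 0 ≤ T)
    (hf : ∀ i ∈ S, ContinuousOn (f i) (rectBoundary U T)) :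
    rectInt (fun s => ∑ i ∈ S, f i s) U T = ∑ i ∈ S, rectInt (f i) U T := by
  classical
  induction S using Finset.induction_on with
  | empty => simp [rectInt]
  | insert a S ha ih =>
    have hS := fun i hi => hf i (Finset.mem_insert_of_mem hi)
    simp only [Finset.sum_insert ha]
    rw [rectInt_add hU hT (hf a (Finset.mem_insert_self a S)) (continuousOn_finsetSum S hS), ih hS]

lemma rectInt_eq_zero_of_differentiableAt (hU : 0 ≤ U) (hT : 0 ≤ T)
    (hf : ∀ s : ℂ, |s.re| ≤ U → |s.im| ≤ T → DifferentiableAt ℂ f s) : rectInt f U T = 0 := by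
  have h := Complex.integral_boundary_rect_eq_zero_of_differentiableOn f ⟨-U, -T⟩ ⟨U, T⟩ (by
    intro s hs
    rw [Complex.mem_reProdIm, Set.uIcc_of_le (by linarith), Set.uIcc_of_le (by linarith)] at hs
    exact (hf s (abs_le.2 hs.1) (abs_le.2 hs.2)).differentiableWithinAt)
  simpa [rectInt] using h

lemma integral_horizontal_eq_sub {a b t : ℝ}
    (hf : IntervalIntegrable (fun x : ℝ => f (x + t * I)) MeasureTheory.volume a b)
    (hF : ∀ x ∈ Set.uIcc a b, HasDerivAt F (f (x + t * I)) (x + t * I)) :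
    ∫ x : ℝ in a..b, f (x + t * I) = F (b + t * I) - F (a + t * I) := by
  refine intervalIntegral.integral_eq_sub_of_hasDerivAt
    (f := fun x : ℝ => F (x + t * I)) (fun x hx => ?_) hf
  have hline : HasDerivAt (fun x : ℝ => (x : ℂ) + t * I) 1 x :=
    (Complex.ofRealCLM.hasDerivAt (x := x)).add_const _
  simpa [Function.comp_def] using (hF x hx).comp x hline

lemma integral_vertical_eq_sub {a b u : ℝ}
    (hf : IntervalIntegrable (fun y : ℝ => f (u + y * I)) MeasureTheory.volume a b)
    (hF : ∀ y ∈ Set.uIcc a b, HasDerivAt F (f (u + y * I)) (u + y * I)) :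
    I * ∫ y : ℝ in a..b, f (u + y * I) = F (u + b * I) - F (u + a * I) := by
  rw [← intervalIntegral.integral_const_mul]
  refine intervalIntegral.integral_eq_sub_of_hasDerivAt
    (f := fun y : ℝ => F (u + y * I)) (fun y hy => ?_) (hf.const_mul I)
  have hline : HasDerivAt (fun y : ℝ => (u : ℂ) + y * I) I y := by
    simpa using ((Complex.ofRealCLM.hasDerivAt (x := y)).mul_const I).const_add (u : ℂ)
  simpa [Function.comp_def, mul_comm] using (hF y hy).comp y hline

lemma rectInt_eq_zero_of_hasDerivAt (hU : 0 ≤ U) (hT : 0 ≤ T)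
    (hf : ContinuousOn f (rectBoundary U T))
    (hF : ∀ s ∈ rectBoundary U T, HasDerivAt F (f s) s) : rectInt f U T = 0 := by
  have hor {t : ℝ} (ht : |t| = T) := integral_horizontal_eq_sub
    (intervalIntegrable_horizontal hU hf ht) fun x hx => hF _ (horizontal_mem_rectBoundary hU ht hx)
  have ver {u : ℝ} (hu : |u| = U) := integral_vertical_eq_sub
    (intervalIntegrable_vertical hT hf hu) fun y hy => hF _ (vertical_mem_rectBoundary hT hu hy)
  rw [rectInt, hor (by rwa [abs_neg, abs_of_nonneg]), hor (abs_of_nonneg hT),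
    ver (abs_of_nonneg hU), ver (by rwa [abs_neg, abs_of_nonneg])]
  ring

lemma sub_ne_zero_of_mem_rectBoundary (hp : |p.re| < U) (hp' : |p.im| < T) {s : ℂ}
    (hs : s ∈ rectBoundary U T) : s - p ≠ 0 := by
  rintro h
  obtain rfl := sub_eq_zero.1 h
  rcases hs.2.2 with h | h <;> linarith

lemma continuousOn_inv_sub_rectBoundary (hp : |p.re| < U) (hp' : |p.im| < T) :
    ContinuousOn (fun s => (s - p)⁻¹) (rectBoundary U T) :=
  ContinuousOn.inv₀ (by fun_prop) fun _ => sub_ne_zero_of_mem_rectBoundary hp hp'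

lemma hasDerivAt_log_sub {s : ℂ} (h : s - p ∈ Complex.slitPlane) :
    HasDerivAt (fun s => Complex.log (s - p)) (s - p)⁻¹ s := by
  simpa using ((hasDerivAt_id s).sub_const p).clog h

lemma hasDerivAt_log_const_sub {s : ℂ} (h : p - s ∈ Complex.slitPlane) :
    HasDerivAt (fun s => Complex.log (p - s)) (s - p)⁻¹ s := by
  refine ((hasDerivAt_id s).const_sub p).clog h |>.congr_deriv ?_
  rw [id, neg_div, one_div, ← inv_neg, neg_sub]

lemma log_neg_of_im_pos {z : ℂ} (h : 0 < z.im) : Complex.log (-z) = Complex.log z - π * I := by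
  rw [Complex.log, Complex.log, norm_neg, Complex.arg_neg_eq_arg_sub_pi_of_im_pos h]
  push_cast
  ring

lemma log_neg_of_im_neg {z : ℂ} (h : z.im < 0) : Complex.log (-z) = Complex.log z + π * I := by
  rw [Complex.log, Complex.log, norm_neg, Complex.arg_neg_eq_arg_add_pi_of_im_neg h]
  push_cast
  ring

-- The principal branch of `log (s - p)` is a primitive on all sides but the left one, where the
-- branch `log (p - s)` takes over; the two differ by `∓π i` at the left corners.
lemma rectInt_inv_sub (hp : |p.re| < U) (hp' : |p.im| < T) :
    rectInt (fun s => (s - p)⁻¹) U T = 2 * π * I := by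
  have hU : 0 ≤ U := (abs_nonneg _).trans hp.le
  have hT : 0 ≤ T := (abs_nonneg _).trans hp'.le
  have hc := continuousOn_inv_sub_rectBoundary hp hp'
  rw [abs_lt] at hp hp'
  have hor {t : ℝ} (ht : |t| = T) (htp : t - p.im ≠ 0) :=
    integral_horizontal_eq_sub (f := fun s => (s - p)⁻¹) (F := fun s => Complex.log (s - p))
      (intervalIntegrable_horizontal hU hc ht)
      fun x _ => hasDerivAt_log_sub (.inr (by simpa using htp))
  have right := integral_vertical_eq_sub
    (f := fun s => (s - p)⁻¹) (F := fun s => Complex.log (s - p))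
    (intervalIntegrable_vertical hT hc (abs_of_nonneg hU))
    fun y _ => hasDerivAt_log_sub (.inl (by simpa using hp.2))
  have left := integral_vertical_eq_sub
    (f := fun s => (s - p)⁻¹) (F := fun s => Complex.log (p - s)) (u := -U)
    (intervalIntegrable_vertical hT hc (by rwa [abs_neg, abs_of_nonneg]))
    fun y _ => hasDerivAt_log_const_sub (.inl (by simpa [neg_lt_iff_pos_add] using hp.1))
  rw [rectInt, hor (by rwa [abs_neg, abs_of_nonneg]) (by linarith),
    hor (abs_of_nonneg hT) (by linarith), right, left,
    ← neg_sub (_ + (T : ℂ) * I), ← neg_sub (_ + ((-T : ℝ) : ℂ) * I),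
    log_neg_of_im_pos (by simpa using hp'.2), log_neg_of_im_neg (by simpa using hp'.1)]
  ring

lemma rectInt_inv_sub_pow (hp : |p.re| < U) (hp' : |p.im| < T) (n : ℕ) :
    rectInt (fun s => (s - p)⁻¹ ^ (n + 2)) U T = 0 := by
  refine rectInt_eq_zero_of_hasDerivAt (F := fun s => -(n + 1 : ℂ)⁻¹ * (s - p)⁻¹ ^ (n + 1))
    ((abs_nonneg _).trans hp.le) ((abs_nonneg _).trans hp'.le)
    ((continuousOn_inv_sub_rectBoundary hp hp').pow _) fun s hs => ?_
  have hs0 := sub_ne_zero_of_mem_rectBoundary hp hp' hs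
  have hn : (n + 1 : ℂ) ≠ 0 := Nat.cast_add_one_ne_zero n
  refine ((((hasDerivAt_id s).sub_const p).fun_inv hs0).fun_pow (n + 1)).const_mul _
    |>.congr_deriv ?_
  simp only [id, Nat.add_sub_cancel]
  push_cast
  simp only [inv_pow]
  field_simp
  ring

end RectangleIntegrals

section Residues

variable {f g : ℂ → ℂ} {p s c : ℂ} {U T : ℝ}

/-- The principal part at `p` with coefficients `q`: the coefficient of `X ^ n` is that of
`(s - p) ^ (-(n + 1))`. -/
noncomputable def principalPart (q : ℂ[X]) (p s : ℂ) : ℂ :=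
  q.eval (s - p)⁻¹ * (s - p)⁻¹

/-- `f` has at most a pole at `p`, with residue `c`. -/
def HasResidueAt (f : ℂ → ℂ) (p c : ℂ) : Prop :=
  ∃ (q : ℂ[X]) (g : ℂ → ℂ), q.coeff 0 = c ∧ AnalyticAt ℂ g p ∧
    ∀ᶠ s in 𝓝[≠] p, f s = principalPart q p s + g s

lemma analyticAt_principalPart (q : ℂ[X]) (h : s ≠ p) : AnalyticAt ℂ (principalPart q p) s := by
  have hinv : AnalyticAt ℂ (fun s => (s - p)⁻¹) s :=
    AnalyticAt.inv (by fun_prop) (sub_ne_zero.2 h)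
  exact (hinv.aeval_polynomial q).mul hinv

lemma rectInt_principalPart (hp : |p.re| < U) (hp' : |p.im| < T) (q : ℂ[X]) :
    rectInt (principalPart q p) U T = 2 * π * I * q.coeff 0 := by
  have hexpand : principalPart q p = fun s => ∑ n ∈ Finset.range (q.natDegree + 1),
      q.coeff n * (s - p)⁻¹ ^ (n + 1) := by
    ext s
    simp only [principalPart, Polynomial.eval_eq_sum_range, Finset.sum_mul, pow_succ, mul_assoc]
  rw [hexpand, rectInt_sum _ ((abs_nonneg _).trans hp.le) ((abs_nonneg _).trans hp'.le) fun n _ =>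
    continuousOn_const.fun_mul ((continuousOn_inv_sub_rectBoundary hp hp').fun_pow _)]
  simp only [rectInt_const_mul, Finset.sum_range_succ', rectInt_inv_sub_pow hp hp', add_assoc,
    one_add_one_eq_two, mul_zero, Finset.sum_const_zero, zero_add, pow_one, rectInt_inv_sub hp hp']
  ring

lemma HasResidueAt.congr (hf : HasResidueAt f p c) (h : g =ᶠ[𝓝[≠] p] f) : HasResidueAt g p c := by
  obtain ⟨q, r, hq, hr, hqr⟩ := hf
  exact ⟨q, r, hq, hr, h.trans hqr⟩

lemma HasResidueAt.add_analyticAt (hf : HasResidueAt f p c) (hg : AnalyticAt ℂ g p) :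
    HasResidueAt (fun s => f s + g s) p c := by
  obtain ⟨q, r, hq, hr, hqr⟩ := hf
  exact ⟨q, fun s => r s + g s, hq, hr.add hg, hqr.mono fun s hs => by
    simp only [hs, add_assoc]⟩

lemma HasResidueAt.exists_eq_principalPart_add (hf : HasResidueAt f p c) :
    ∃ (q : ℂ[X]) (h : ℂ → ℂ), q.coeff 0 = c ∧ AnalyticAt ℂ h p ∧
      ∀ s ≠ p, f s = principalPart q p s + h s := by
  classical
  obtain ⟨q, g, hq, hg, hqg⟩ := hf
  refine ⟨q, Function.update (fun s => f s - principalPart q p s) p (g p), hq, hg.congr ?_,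
    fun s hs => by rw [Function.update_of_ne hs]; ring⟩
  filter_upwards [eventually_nhdsWithin_iff.1 hqg] with s hs
  rcases eq_or_ne s p with rfl | hsp
  · rw [Function.update_self]
  · rw [Function.update_of_ne hsp, hs hsp, add_sub_cancel_left]

theorem rectInt_eq_sum_residues {κ : Type*} (S : Finset κ) {z c : κ → ℂ} (hz : Set.InjOn z S)
    (hU : 0 ≤ U) (hT : 0 ≤ T) (hS : ∀ i ∈ S, |(z i).re| < U ∧ |(z i).im| < T)
    (hf : ∀ s : ℂ, |s.re| ≤ U → |s.im| ≤ T → (∀ i ∈ S, s ≠ z i) → AnalyticAt ℂ f s)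
    (hres : ∀ i ∈ S, HasResidueAt f (z i) (c i)) :
    rectInt f U T = 2 * π * I * ∑ i ∈ S, c i := by
  classical
  induction S using Finset.induction_on generalizing f with
  | empty =>
    simpa using rectInt_eq_zero_of_differentiableAt hU hT fun s h h' =>
      (hf s h h' (by simp)).differentiableAt
  | insert i S hi ih =>
    obtain ⟨hresi, hres⟩ := (Finset.forall_mem_insert _ _ _).1 hres
    obtain ⟨⟨hin, hin'⟩, hS⟩ := (Finset.forall_mem_insert _ _ _).1 hS
    obtain ⟨q, h, hq, hh, hqh⟩ := hresi.exists_eq_principalPart_add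
    have hP (s) (hs : s ≠ z i) : AnalyticAt ℂ (fun s => -principalPart q (z i) s) s :=
      (analyticAt_principalPart q hs).neg
    have hsub (s) (hs : s ≠ z i) : h =ᶠ[𝓝 s] fun s => f s + -principalPart q (z i) s :=
      (eventually_ne_nhds hs).mono fun w hw => by simp only [hqh w hw]; ring
    have han (s : ℂ) (h₁ : |s.re| ≤ U) (h₂ : |s.im| ≤ T) (hsS : ∀ j ∈ S, s ≠ z j) :
        AnalyticAt ℂ h s := by
      rcases eq_or_ne s (z i) with rfl | hsi
      · exact hh
      · exact ((hf s h₁ h₂ (by simpa [hsi] using hsS)).add (hP s hsi)).congr (hsub s hsi).symm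
    have hres' : ∀ j ∈ S, HasResidueAt h (z j) (c j) := fun j hj => by
      have hji : z j ≠ z i := fun e => hi (hz (by simp [hj]) (by simp) e ▸ hj)
      exact ((hres j hj).add_analyticAt (hP _ hji)).congr
        ((hsub _ hji).filter_mono nhdsWithin_le_nhds)
    have hne (s) (hs : s ∈ rectBoundary U T) : s ≠ z i :=
      sub_ne_zero.1 (sub_ne_zero_of_mem_rectBoundary hin hin' hs)
    have hbd (s) (hs : s ∈ rectBoundary U T) : ∀ j ∈ S, s ≠ z j := fun j hj =>
      sub_ne_zero.1 (sub_ne_zero_of_mem_rectBoundary (hS j hj).1 (hS j hj).2 hs)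
    rw [rectInt_congr hU hT fun s hs => hqh s (hne s hs), rectInt_add hU hT
        (fun s hs => (analyticAt_principalPart q (hne s hs)).continuousAt.continuousWithinAt)
        (fun s hs => (han s hs.1 hs.2.1 (hbd s hs)).continuousAt.continuousWithinAt),
      rectInt_principalPart hin hin', ih (hz.mono (by simp)) hS han hres', hq,
      Finset.sum_insert hi, mul_add]

end Residues

section TaylorSeries

variable {f g : ℂ → ℂ} {p : ℂ}

/-- The Taylor series of `f` at `0`, as a formal power series. -/
noncomputable def taylorSeries (f : ℂ → ℂ) : ℂ⟦X⟧ :=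
  PowerSeries.mk fun n => iteratedDeriv n f 0 / n.factorial

lemma taylorSeries_const (c : ℂ) : taylorSeries (fun _ => c) = PowerSeries.C c := by
  ext n
  rcases eq_or_ne n 0 with rfl | hn <;>
    simp [taylorSeries, iteratedDeriv_const, PowerSeries.coeff_C, *]

lemma taylorSeries_sub (hf : AnalyticAt ℂ f 0) (hg : AnalyticAt ℂ g 0) :
    taylorSeries (fun s => f s - g s) = taylorSeries f - taylorSeries g := by
  ext n
  simp [taylorSeries, iteratedDeriv_fun_sub hf.contDiffAt hg.contDiffAt, sub_div]

lemma taylorSeries_mul (hf : AnalyticAt ℂ f 0) (hg : AnalyticAt ℂ g 0) :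
    taylorSeries (fun s => f s * g s) = taylorSeries f * taylorSeries g := by
  ext n
  simp only [taylorSeries, PowerSeries.coeff_mk, PowerSeries.coeff_mul,
    iteratedDeriv_fun_mul hf.contDiffAt hg.contDiffAt, Finset.sum_div,
    Finset.Nat.sum_antidiagonal_eq_sum_range_succ_mk, Nat.succ_eq_add_one]
  refine Finset.sum_congr rfl fun i hi => ?_
  rw [Nat.cast_choose _ (by grind)]
  field_simp [Nat.factorial_ne_zero]

lemma taylorSeries_prod {κ : Type*} (A : Finset κ) {f : κ → ℂ → ℂ}
    (hf : ∀ i ∈ A, AnalyticAt ℂ (f i) 0) :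
    taylorSeries (fun s => ∏ i ∈ A, f i s) = ∏ i ∈ A, taylorSeries (f i) := by
  classical
  induction A using Finset.induction_on with
  | empty => simp [taylorSeries_const]
  | insert i A hi ih =>
    obtain ⟨hfi, hfA⟩ := (Finset.forall_mem_insert _ _ _).1 hf
    simp only [Finset.prod_insert hi]
    rw [taylorSeries_mul hfi (Finset.analyticAt_fun_prod A hfA), ih hfA]

lemma taylorSeries_congr (h : f =ᶠ[𝓝 0] g) : taylorSeries f = taylorSeries g := by
  ext n
  simp only [taylorSeries, PowerSeries.coeff_mk, h.iteratedDeriv_eq n]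

lemma taylorSeries_exp_mul (c : ℂ) :
    taylorSeries (fun s => Complex.exp (c * s)) = PowerSeries.rescale c (PowerSeries.exp ℂ) := by
  ext n
  simp [taylorSeries, PowerSeries.coeff_rescale, PowerSeries.coeff_exp, div_eq_mul_inv]

lemma analyticAt_dslope_same (hf : AnalyticAt ℂ f p) : AnalyticAt ℂ (dslope f p) p :=
  let ⟨_, hq⟩ := hf
  ⟨_, hq.has_fpower_series_dslope_fslope⟩

lemma iteratedDeriv_dslope_div_factorial (hf : AnalyticAt ℂ f p) (n : ℕ) :
    iteratedDeriv n (dslope f p) p / n.factorial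
      = iteratedDeriv (n + 1) f p / (n + 1).factorial := by
  have h := congrArg (FormalMultilinearSeries.coeff · n) <|
    (analyticAt_dslope_same hf).hasFPowerSeriesAt.eq_formalMultilinearSeries
      hf.hasFPowerSeriesAt.has_fpower_series_dslope_fslope
  simpa [FormalMultilinearSeries.coeff_ofScalars] using h

lemma X_mul_taylorSeries_dslope (hf : AnalyticAt ℂ f 0) :
    PowerSeries.X * taylorSeries (dslope f 0) = taylorSeries f - PowerSeries.C (f 0) := by
  ext (_ | n)
  · simp [taylorSeries]
  · simp [taylorSeries, PowerSeries.coeff_succ_X_mul,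
      iteratedDeriv_dslope_div_factorial hf]

lemma hasResidueAt_div_sub_pow (hf : AnalyticAt ℂ f p) (n : ℕ) :
    HasResidueAt (fun s => f s / (s - p) ^ (n + 1)) p (iteratedDeriv n f p / n.factorial) := by
  have hsplit (f : ℂ → ℂ) (s : ℂ) : f s = f p + (s - p) * dslope f p s := by
    rw [← smul_eq_mul, sub_smul_dslope, add_sub_cancel]
  induction n generalizing f with
  | zero =>
    refine ⟨Polynomial.C (f p), dslope f p, by simp, analyticAt_dslope_same hf,
      eventually_nhdsWithin_of_forall fun s hs => ?_⟩
    have hs0 : s - p ≠ 0 := sub_ne_zero.2 hs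
    beta_reduce
    rw [hsplit f s, principalPart, Polynomial.eval_C]
    field_simp
    ring
  | succ n ih =>
    obtain ⟨q, g, hq, hg, hqg⟩ := ih (analyticAt_dslope_same hf)
    refine ⟨Polynomial.C (f p) * X ^ (n + 1) + q, g, ?_, hg, ?_⟩
    · simp [hq, iteratedDeriv_dslope_div_factorial hf]
    · filter_upwards [hqg, self_mem_nhdsWithin] with s hs hsp
      have hs0 : s - p ≠ 0 := sub_ne_zero.2 hsp
      have hstep : f s / (s - p) ^ (n + 2)
          = f p * (s - p)⁻¹ ^ (n + 2) + dslope f p s / (s - p) ^ (n + 1) := by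
        rw [hsplit f s, inv_pow]
        field_simp
        ring
      rw [hstep, hs, principalPart, principalPart, Polynomial.eval_add, Polynomial.eval_mul,
        Polynomial.eval_C, Polynomial.eval_pow, Polynomial.eval_X]
      ring

end TaylorSeries

section ToddSeries

/-- The Taylor series of the Todd function `s / (1 - exp (-a * s))`, for `a ≠ 0`. -/
noncomputable def toddSeries (a : ℝ) : ℝ⟦X⟧ :=
  PowerSeries.C a⁻¹ * PowerSeries.rescale a (bernoulli'PowerSeries ℝ)

lemma coeff_toddSeries (a : ℝ) (n : ℕ) :
    PowerSeries.coeff n (toddSeries a) = a⁻¹ * (a ^ n * (bernoulli' n / n.factorial)) := by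
  simp [toddSeries, bernoulli'PowerSeries]

lemma toddSeries_mul_one_sub_exp {a : ℝ} (ha : a ≠ 0) :
    toddSeries a * (1 - PowerSeries.rescale (-a) (PowerSeries.exp ℝ)) = PowerSeries.X := by
  have hB := congrArg (PowerSeries.rescale a) (bernoulli'PowerSeries_mul_exp_sub_one ℝ)
  have hexp := PowerSeries.exp_mul_exp_eq_exp_add (A := ℝ) a (-a)
  have hC : PowerSeries.C a⁻¹ * PowerSeries.C a = (1 : ℝ⟦X⟧) := by
    rw [← map_mul, inv_mul_cancel₀ ha, map_one]
  simp only [map_mul, map_sub, map_one, PowerSeries.rescale_X] at hB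
  simp only [add_neg_cancel, PowerSeries.rescale_zero, RingHom.comp_apply,
    PowerSeries.constantCoeff_exp, map_one] at hexp
  rw [toddSeries]
  linear_combination PowerSeries.C a⁻¹ * PowerSeries.rescale (-a) (PowerSeries.exp ℝ) * hB
    + PowerSeries.X * hC + PowerSeries.C a⁻¹ * (PowerSeries.C a * PowerSeries.X
      - PowerSeries.rescale a (bernoulli'PowerSeries ℝ)) * hexp

/-- The Todd function `s / (1 - exp (-a * s))`, with its removable singularity at `0` removed. -/
noncomputable def toddFun (a : ℝ) (s : ℂ) : ℂ :=
  (dslope (fun s => 1 - Complex.exp (-a * s)) 0 s)⁻¹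

variable {a : ℝ}

lemma toddFun_of_ne_zero {s : ℂ} (hs : s ≠ 0) : toddFun a s = s / (1 - Complex.exp (-a * s)) := by
  rw [toddFun, dslope_of_ne _ hs]
  simp [slope_def_field]

lemma dslope_one_sub_exp {p : ℂ} (hp : Complex.exp (-a * p) = 1) :
    dslope (fun s : ℂ => 1 - Complex.exp (-a * s)) p p = a := by
  have h : HasDerivAt (fun s : ℂ => -(a : ℂ) * s) (-a) p := by
    simpa using (hasDerivAt_id p).const_mul (-(a : ℂ))
  rw [dslope_same, (h.cexp.const_sub 1).deriv, hp]
  simp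

lemma analyticAt_toddFun (ha : a ≠ 0) : AnalyticAt ℂ (toddFun a) 0 :=
  (analyticAt_dslope_same (by fun_prop)).inv
    (by rw [dslope_one_sub_exp (by simp)]; exact_mod_cast ha)

lemma taylorSeries_toddFun (ha : a ≠ 0) :
    taylorSeries (toddFun a) = (toddSeries a).map (algebraMap ℝ ℂ) := by
  set D : ℂ → ℂ := dslope (fun s : ℂ => 1 - Complex.exp (-a * s)) 0 with hD
  set E := 1 - PowerSeries.rescale (-a : ℂ) (PowerSeries.exp ℂ) with hE
  have hDan : AnalyticAt ℂ D 0 := analyticAt_dslope_same (by fun_prop)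
  have hXD : PowerSeries.X * taylorSeries D = E := by
    rw [hD, X_mul_taylorSeries_dslope (by fun_prop), taylorSeries_sub (by fun_prop) (by fun_prop),
      taylorSeries_const, taylorSeries_exp_mul]
    simp [hE]
  have hTD : taylorSeries (toddFun a) * taylorSeries D = 1 := by
    have hD0 : ∀ᶠ s in 𝓝 0, D s ≠ 0 := hDan.continuousAt.eventually_ne
      (by rw [hD, dslope_one_sub_exp (by simp)]; exact_mod_cast ha)
    rw [← taylorSeries_mul (analyticAt_toddFun ha) hDan, taylorSeries_congr (g := fun _ => 1),
      taylorSeries_const, map_one]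
    exact hD0.mono fun s hs => inv_mul_cancel₀ hs
  have hSE : (toddSeries a).map (algebraMap ℝ ℂ) * E = PowerSeries.X := by
    have h := congrArg (PowerSeries.map (algebraMap ℝ ℂ)) (toddSeries_mul_one_sub_exp ha)
    rw [map_mul, map_sub, map_one, ← PowerSeries.rescale_map, PowerSeries.map_exp,
      PowerSeries.map_X] at h
    simpa [hE] using h
  refine mul_right_cancel₀ (b := E) ?_ (hSE.symm ▸ ?_)
  · rintro h
    exact PowerSeries.X_ne_zero (R := ℂ) (by simpa [h] using hSE.symm)
  · rw [← hXD, mul_left_comm, hTD, mul_one]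

end ToddSeries

section Kernel

/-- The frequencies in `A` are positive and pairwise incommensurable, so that all the nonzero poles
of `kernel A L` are simple. -/
structure Incommensurable (A : Finset ℝ) : Prop where
  pos : ∀ a ∈ A, 0 < a
  irrational_div : ∀ a ∈ A, ∀ b ∈ A, a ≠ b → Irrational (a / b)

/-- The zeros `2 * π * k * I / a` of `1 - exp (-a * s)`. -/
noncomputable def pole (a : ℝ) (k : ℤ) : ℂ :=
  (2 * π * k / a : ℝ) * I

/-- The Laplace transform (times `exp (L * s)`) of the function which counts with multiplicity the
combinations at most `L` of the frequencies in `A` with natural coefficients. -/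
noncomputable def kernel (A : Finset ℝ) (L : ℝ) (s : ℂ) : ℂ :=
  Complex.exp (L * s) / (s * ∏ a ∈ A, (1 - Complex.exp (-a * s)))

/-- The residue of `kernel A L` at `0`. -/
noncomputable def zeroResidue (A : Finset ℝ) (L : ℝ) : ℝ :=
  PowerSeries.coeff A.card
    (PowerSeries.rescale L (PowerSeries.exp ℝ) * ∏ a ∈ A, toddSeries a)

/-- The residue of `kernel A L` at `pole a k`, where `a ∈ A` and `k ≠ 0`. -/
noncomputable def poleResidue (A : Finset ℝ) (L a : ℝ) (k : ℤ) : ℂ :=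
  Complex.exp (L * pole a k)
    / (pole a k * a * ∏ b ∈ A.erase a, (1 - Complex.exp (-b * pole a k)))

/-- The sum of the residues of `kernel A L` at its poles of height at most `2 * π * R`. The poles
`pole a k` and `pole a (-k)` are complex conjugate, and so are their residues. -/
noncomputable def totalResidue (A : Finset ℝ) (L R : ℝ) : ℝ :=
  zeroResidue A L + ∑ a ∈ A, ∑ k ∈ Finset.Icc 1 ⌊R * a⌋₊, 2 * (poleResidue A L a k).re

variable {A B : Finset ℝ} {a b L R U : ℝ} {k m : ℤ} {s : ℂ}

lemma Incommensurable.mono (hB : Incommensurable B) (h : A ⊆ B) : Incommensurable A :=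
  ⟨fun a ha => hB.pos a (h ha), fun a ha b hb => hB.irrational_div a (h ha) b (h hb)⟩

lemma pole_re : (pole a k).re = 0 := by
  simp only [pole, Complex.re_ofReal_mul, Complex.I_re, mul_zero]

lemma pole_im : (pole a k).im = 2 * π * k / a := by
  simp only [pole, Complex.im_ofReal_mul, Complex.I_im, mul_one]

lemma abs_pole_im (ha : 0 < a) : |(pole a k).im| = 2 * π * (|(k : ℝ)| / a) := by
  rw [pole_im, mul_div_assoc, abs_mul, abs_of_pos Real.two_pi_pos, abs_div, abs_of_pos ha]

lemma pole_ne_zero (ha : a ≠ 0) (hk : k ≠ 0) : pole a k ≠ 0 := by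
  simp [pole, ha, hk, Real.pi_ne_zero]

lemma conj_pole : (starRingEnd ℂ) (pole a k) = pole a (-k) := by
  simp only [pole, map_mul, Complex.conj_ofReal, Complex.conj_I]
  push_cast
  ring

lemma one_sub_exp_eq_zero_iff (ha : a ≠ 0) :
    1 - Complex.exp (-a * s) = 0 ↔ ∃ k : ℤ, s = pole a k := by
  have ha' : (a : ℂ) ≠ 0 := by exact_mod_cast ha
  rw [sub_eq_zero, eq_comm, Complex.exp_eq_one_iff]
  constructor
  · rintro ⟨n, hn⟩
    refine ⟨-n, ?_⟩
    rw [pole]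
    push_cast
    field_simp
    linear_combination -hn
  · rintro ⟨k, rfl⟩
    refine ⟨-k, ?_⟩
    rw [pole]
    push_cast
    field_simp

lemma exp_neg_mul_pole (ha : a ≠ 0) : Complex.exp (-a * pole a k) = 1 :=
  (sub_eq_zero.1 ((one_sub_exp_eq_zero_iff ha).2 ⟨k, rfl⟩)).symm

lemma pole_eq_pole_iff (ha : a ≠ 0) (hb : b ≠ 0) :
    pole a k = pole b m ↔ (k : ℝ) * b = m * a := by
  rw [Complex.ext_iff, pole_re, pole_re, pole_im, pole_im, div_eq_div_iff ha hb, mul_assoc,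
    mul_assoc _ (m : ℝ), mul_right_inj' Real.two_pi_pos.ne']
  simp

lemma pole_injective (ha : a ≠ 0) : Function.Injective (pole a) := fun k m h => by
  exact_mod_cast mul_right_cancel₀ ha ((pole_eq_pole_iff ha ha).1 h)

lemma pole_ne_pole (h : Irrational (a / b)) (hk : k ≠ 0) (m : ℤ) : pole a k ≠ pole b m := by
  have ⟨ha, hb⟩ := div_ne_zero_iff.1 h.ne_zero
  intro hp
  rw [pole_eq_pole_iff ha hb] at hp
  have hm : (m : ℝ) ≠ 0 := by
    rintro hm
    simp [hm, hk, hb] at hp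
  exact h ⟨(k : ℚ) / m, by push_cast; rw [div_eq_div_iff hm hb, hp, mul_comm]⟩

lemma one_sub_exp_pole_ne_zero (h : Irrational (a / b)) (hk : k ≠ 0) :
    1 - Complex.exp (-b * pole a k) ≠ 0 := by
  rw [Ne, one_sub_exp_eq_zero_iff (div_ne_zero_iff.1 h.ne_zero).2]
  rintro ⟨m, hm⟩
  exact pole_ne_pole h hk m hm

lemma analyticAt_kernel (hs : s ≠ 0) (h : ∀ a ∈ A, 1 - Complex.exp (-a * s) ≠ 0) :
    AnalyticAt ℂ (kernel A L) s :=
  AnalyticAt.fun_div (by fun_prop)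
    (analyticAt_id.fun_mul (Finset.analyticAt_fun_prod _ fun a _ => by fun_prop))
    (mul_ne_zero hs (Finset.prod_ne_zero_iff.2 h))

lemma kernel_eq_prod_toddFun_div (hs : s ≠ 0) :
    kernel A L s = Complex.exp (L * s) * (∏ a ∈ A, toddFun a s) / (s - 0) ^ (A.card + 1) := by
  rw [kernel, Finset.prod_congr rfl fun a _ => toddFun_of_ne_zero hs, Finset.prod_div_distrib,
    Finset.prod_const, sub_zero, pow_succ]
  field_simp

lemma hasResidueAt_kernel_zero (hA : ∀ a ∈ A, a ≠ 0) :
    HasResidueAt (kernel A L) 0 (zeroResidue A L) := by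
  have htodd : ∀ a ∈ A, AnalyticAt ℂ (toddFun a) 0 := fun a ha => analyticAt_toddFun (hA a ha)
  have hF := (by fun_prop : AnalyticAt ℂ (fun s => Complex.exp (L * s)) 0)
  have hseries : taylorSeries (fun s => Complex.exp (L * s) * ∏ a ∈ A, toddFun a s)
      = (PowerSeries.rescale L (PowerSeries.exp ℝ) * ∏ a ∈ A, toddSeries a).map
        (algebraMap ℝ ℂ) := by
    rw [taylorSeries_mul hF (Finset.analyticAt_fun_prod A htodd), taylorSeries_exp_mul,
      taylorSeries_prod A htodd, Finset.prod_congr rfl fun a ha => taylorSeries_toddFun (hA a ha),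
      map_mul, map_prod, ← PowerSeries.rescale_map, PowerSeries.map_exp, Complex.coe_algebraMap]
  have hres := hasResidueAt_div_sub_pow (hF.fun_mul (Finset.analyticAt_fun_prod A htodd)) A.card
  have hcoeff := congrArg (PowerSeries.coeff A.card) hseries
  rw [taylorSeries, PowerSeries.coeff_mk, PowerSeries.coeff_map, Complex.coe_algebraMap,
    ← zeroResidue] at hcoeff
  rw [hcoeff] at hres
  exact hres.congr (eventually_nhdsWithin_of_forall fun s hs => kernel_eq_prod_toddFun_div hs)

lemma hasResidueAt_kernel_pole (hA : Incommensurable A) (ha : a ∈ A) (hk : k ≠ 0) :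
    HasResidueAt (kernel A L) (pole a k) (poleResidue A L a k) := by
  have ha0 : a ≠ 0 := (hA.pos a ha).ne'
  set D : ℂ → ℂ := dslope (fun s : ℂ => 1 - Complex.exp (-a * s)) (pole a k)
  set F : ℂ → ℂ := fun s =>
    Complex.exp (L * s) / (s * D s * ∏ b ∈ A.erase a, (1 - Complex.exp (-b * s)))
  have hDp : D (pole a k) = a := dslope_one_sub_exp (exp_neg_mul_pole ha0)
  have hF : AnalyticAt ℂ F (pole a k) := by
    refine AnalyticAt.fun_div (by fun_prop) ?_ (mul_ne_zero (mul_ne_zero (pole_ne_zero ha0 hk) ?_)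
      (Finset.prod_ne_zero_iff.2 fun b hb => ?_))
    · exact (analyticAt_id.fun_mul (analyticAt_dslope_same (by fun_prop))).fun_mul
        (Finset.analyticAt_fun_prod _ fun b _ => by fun_prop)
    · rw [hDp]
      exact_mod_cast ha0
    · have ⟨hba, hb⟩ := Finset.mem_erase.1 hb
      exact one_sub_exp_pole_ne_zero (hA.irrational_div a ha b hb hba.symm) hk
  have hres := hasResidueAt_div_sub_pow hF 0
  rw [iteratedDeriv_zero, Nat.factorial_zero, Nat.cast_one, div_one] at hres
  have hkernel (s : ℂ) : kernel A L s = F s / (s - pole a k) ^ (0 + 1) := by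
    have hD : (s - pole a k) * D s = 1 - Complex.exp (-a * s) := by
      rw [← smul_eq_mul, sub_smul_dslope, exp_neg_mul_pole ha0]
      ring
    rw [kernel, ← Finset.mul_prod_erase A _ ha, ← hD, zero_add, pow_one, div_div]
    ring
  have hFp : F (pole a k) = poleResidue A L a k := by
    simp only [F, hDp, poleResidue]
  exact (hFp ▸ hres).congr (Eventually.of_forall hkernel)

lemma conj_poleResidue : (starRingEnd ℂ) (poleResidue A L a k) = poleResidue A L a (-k) := by
  simp only [poleResidue, map_div₀, map_mul, map_prod, map_sub, map_one, ← Complex.exp_conj,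
    map_neg, Complex.conj_ofReal, conj_pole]

lemma mem_Icc_neg_floor_iff {y : ℝ} (hy : 0 ≤ y) :
    k ∈ Finset.Icc (-(⌊y⌋₊ : ℤ)) ⌊y⌋₊ ↔ |(k : ℝ)| ≤ y := by
  rw [Finset.mem_Icc, ← abs_le, Int.abs_eq_natAbs, Nat.cast_le, Nat.le_floor_iff hy,
    Nat.cast_natAbs, Int.cast_abs]

lemma sum_Icc_neg_erase_zero {M : Type*} [AddCommMonoid M] (f : ℤ → M) (n : ℕ) :
    ∑ k ∈ (Finset.Icc (-(n : ℤ)) n).erase 0, f k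
      = ∑ k ∈ Finset.Icc 1 n, (f k + f (-(k : ℤ))) := by
  induction n with
  | zero => simp
  | succ n ih =>
    have hinsert : (Finset.Icc (-((n + 1 : ℕ) : ℤ)) (n + 1 : ℕ)).erase 0
        = insert ((n + 1 : ℕ) : ℤ) (insert (-((n + 1 : ℕ) : ℤ))
          ((Finset.Icc (-(n : ℤ)) n).erase 0)) := by
      ext k
      simp only [Finset.mem_erase, Finset.mem_Icc, Finset.mem_insert]
      lia
    rw [Finset.sum_Icc_succ_top (by lia), ← ih, hinsert, Finset.sum_insert (by simp; lia),
      Finset.sum_insert (by simp), ← add_assoc, add_comm]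

lemma sum_poleResidue_eq {y : ℝ} :
    ∑ k ∈ (Finset.Icc (-(⌊y⌋₊ : ℤ)) ⌊y⌋₊).erase 0, poleResidue A L a k
      = ∑ k ∈ Finset.Icc 1 ⌊y⌋₊, (2 * (poleResidue A L a k).re : ℝ) := by
  rw [sum_Icc_neg_erase_zero]
  push_cast
  exact Finset.sum_congr rfl fun k _ => by
    rw [← conj_poleResidue, Complex.add_conj]
    push_cast
    rfl

/-- The indices `(a, k)` of the nonzero poles of `kernel A L` of height at most `2 * π * R`. -/
noncomputable def poleIndex (A : Finset ℝ) (R : ℝ) : Finset (Σ _ : ℝ, ℤ) :=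
  A.sigma fun a => (Finset.Icc (-(⌊R * a⌋₊ : ℤ)) ⌊R * a⌋₊).erase 0

lemma mem_poleIndex (hA : ∀ a ∈ A, 0 < a) (hR : 0 < R) {q : Σ _ : ℝ, ℤ} :
    q ∈ poleIndex A R ↔ q.1 ∈ A ∧ q.2 ≠ 0 ∧ |(pole q.1 q.2).im| ≤ 2 * π * R := by
  rw [poleIndex, Finset.mem_sigma, Finset.mem_erase]
  refine and_congr_right fun ha => and_congr_right fun _ => ?_
  rw [mem_Icc_neg_floor_iff (mul_pos hR (hA _ ha)).le, abs_pole_im (hA _ ha),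
    mul_le_mul_iff_right₀ Real.two_pi_pos, div_le_iff₀ (hA _ ha)]

lemma abs_pole_im_ne (ha : 0 < a) (h : ∀ n : ℤ, R * a ≠ n) : |(pole a k).im| ≠ 2 * π * R := by
  rw [abs_pole_im ha, Ne, mul_right_inj' Real.two_pi_pos.ne', div_eq_iff ha.ne', eq_comm,
    ← Int.cast_abs]
  exact h |k|

lemma injOn_option_pole (hA : Incommensurable A) (hR : 0 < R) :
    Set.InjOn (fun i : Option (Σ _ : ℝ, ℤ) => i.elim 0 fun q => pole q.1 q.2)
      (Finset.insertNone (poleIndex A R)) := by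
  have hne {q} (h : some q ∈ Finset.insertNone (poleIndex A R)) : q.1 ∈ A ∧ q.2 ≠ 0 :=
    have h' := (mem_poleIndex hA.pos hR).1 (Finset.some_mem_insertNone.1 h)
    ⟨h'.1, h'.2.1⟩
  rintro (_ | ⟨a, k⟩) h₁ (_ | ⟨b, m⟩) h₂ h
  · rfl
  · exact absurd h.symm (pole_ne_zero (hA.pos b (hne h₂).1).ne' (hne h₂).2)
  · exact absurd h (pole_ne_zero (hA.pos a (hne h₁).1).ne' (hne h₁).2)
  · have ha : a ∈ A := (hne h₁).1
    obtain rfl : a = b := by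
      by_contra hab
      exact pole_ne_pole (hA.irrational_div a ha b (hne h₂).1 hab) (hne h₁).2 m h
    obtain rfl : k = m := pole_injective (hA.pos a ha).ne' h
    rfl

theorem rectInt_kernel (hA : Incommensurable A) (hU : 0 < U) (hR : 0 < R)
    (hRA : ∀ a ∈ A, ∀ n : ℤ, R * a ≠ n) :
    rectInt (kernel A L) U (2 * π * R) = 2 * π * I * totalResidue A L R := by
  have hT : 0 < 2 * π * R := mul_pos Real.two_pi_pos hR
  set c : Option (Σ _ : ℝ, ℤ) → ℂ := fun i =>
    i.elim (zeroResidue A L : ℂ) fun q => poleResidue A L q.1 q.2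
  rw [rectInt_eq_sum_residues (c := c) _ (injOn_option_pole hA hR) hU.le hT.le]
  · rw [Finset.sum_insertNone, poleIndex, Finset.sum_sigma, totalResidue]
    simp only [c, Option.elim, sum_poleResidue_eq]
    push_cast
    rfl
  · rintro (_ | ⟨a, k⟩) h
    · simpa using ⟨hU, hT⟩
    · obtain ⟨ha, -, h⟩ := (mem_poleIndex hA.pos hR).1 (Finset.some_mem_insertNone.1 h)
      exact ⟨by simpa [pole_re] using hU, h.lt_of_ne (abs_pole_im_ne (hA.pos a ha) (hRA a ha))⟩
  · intro s _ hs hne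
    have hs0 : s ≠ 0 := hne none (Finset.none_mem_insertNone)
    refine analyticAt_kernel hs0 fun a ha h => ?_
    obtain ⟨k, rfl⟩ := (one_sub_exp_eq_zero_iff (hA.pos a ha).ne').1 h
    have hk : k ≠ 0 := by
      rintro rfl
      simp [pole] at hs0
    exact hne (some ⟨a, k⟩)
      (Finset.some_mem_insertNone.2 ((mem_poleIndex hA.pos hR).2 ⟨ha, hk, hs⟩)) rfl
  · rintro (_ | ⟨a, k⟩) h
    · exact hasResidueAt_kernel_zero fun a ha => (hA.pos a ha).ne'
    · obtain ⟨ha, hk, -⟩ := (mem_poleIndex hA.pos hR).1 (Finset.some_mem_insertNone.1 h)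
      exact hasResidueAt_kernel_pole hA ha hk

end Kernel

section Recursion

variable {A : Finset ℝ} {a b L R : ℝ} {k : ℤ}

lemma zeroResidue_insert (hb : b ≠ 0) (hbA : b ∉ A) :
    zeroResidue (insert b A) L = zeroResidue (insert b A) (L - b) + zeroResidue A L := by
  have hexp : PowerSeries.rescale (L - b) (PowerSeries.exp ℝ)
      = PowerSeries.rescale L (PowerSeries.exp ℝ)
        * PowerSeries.rescale (-b) (PowerSeries.exp ℝ) := by
    rw [PowerSeries.exp_mul_exp_eq_exp_add, sub_eq_add_neg]
  have htodd := toddSeries_mul_one_sub_exp hb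
  rw [zeroResidue, zeroResidue, zeroResidue, Finset.card_insert_of_notMem hbA,
    ← PowerSeries.coeff_succ_X_mul A.card, ← map_add]
  congr 1
  rw [Finset.prod_insert hbA, hexp]
  linear_combination PowerSeries.rescale L (PowerSeries.exp ℝ) * (∏ a ∈ A, toddSeries a) * htodd

lemma exp_sub_mul_pole :
    Complex.exp ((L - b : ℝ) * pole a k)
      = Complex.exp (L * pole a k) * Complex.exp (-b * pole a k) := by
  rw [← Complex.exp_add]
  push_cast
  ring_nf

lemma poleResidue_sub_self (hb : b ≠ 0) : poleResidue A (L - b) b k = poleResidue A L b k := by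
  rw [poleResidue, exp_sub_mul_pole, exp_neg_mul_pole hb, mul_one, poleResidue]

lemma poleResidue_insert (h : Irrational (a / b)) (hbA : b ∉ A) (hk : k ≠ 0) :
    poleResidue (insert b A) L a k
      = poleResidue (insert b A) (L - b) a k + poleResidue A L a k := by
  have hab : a ≠ b := by
    rintro rfl
    exact h.ne_one (div_self (div_ne_zero_iff.1 h.ne_zero).1)
  have hne := one_sub_exp_pole_ne_zero h hk
  have hb : b ∉ A.erase a := fun hb => hbA (Finset.mem_of_mem_erase hb)
  rw [poleResidue, poleResidue, poleResidue, exp_sub_mul_pole,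
    Finset.erase_insert_of_ne hab.symm, Finset.prod_insert hb, mul_left_comm,
    ← mul_div_mul_left (Complex.exp (L * pole a k)) (pole a k * a * ∏ c ∈ A.erase a, _) hne,
    ← add_div]
  ring_nf

lemma totalResidue_empty : totalResidue ∅ L R = 1 := by
  simp [totalResidue, zeroResidue]

lemma totalResidue_insert (hA : Incommensurable (insert b A)) (hbA : b ∉ A) :
    totalResidue (insert b A) L R = totalResidue (insert b A) (L - b) R + totalResidue A L R := by
  have hb0 : b ≠ 0 := (hA.pos b (Finset.mem_insert_self b A)).ne'
  have hpole : ∀ a ∈ A, ∀ k ∈ Finset.Icc 1 ⌊R * a⌋₊, 2 * (poleResidue (insert b A) L a k).re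
      = 2 * (poleResidue (insert b A) (L - b) a k).re + 2 * (poleResidue A L a k).re := by
    intro a ha k hk
    have hirr := hA.irrational_div a (Finset.mem_insert_of_mem ha) b (Finset.mem_insert_self b A)
      (fun h => hbA (h ▸ ha))
    have hk0 : (k : ℤ) ≠ 0 := by
      have := (Finset.mem_Icc.1 hk).1
      lia
    rw [poleResidue_insert hirr hbA hk0, Complex.add_re, mul_add]
  rw [totalResidue, totalResidue, totalResidue, zeroResidue_insert hb0 hbA,
    Finset.sum_insert hbA, Finset.sum_insert hbA,
    Finset.sum_congr rfl fun a ha => Finset.sum_congr rfl (hpole a ha)]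
  simp only [Finset.sum_add_distrib, poleResidue_sub_self hb0]
  ring

end Recursion

section PoleAvoidance

/-- The parameters `R` for which every `R * a` with `a ∈ A` has distance at least `δ` from the
integers. -/
def avoiding (A : Finset ℝ) (δ : ℝ) : Set ℝ :=
  {R | ∀ a ∈ A, ∀ n : ℤ, δ ≤ |R * a - n|}

/-- The filter of those `R → ∞` that stay in some `avoiding A δ` with `δ > 0`. A limit along this
filter is a limit along every `avoiding A δ`. -/
def poleAvoiding (A : Finset ℝ) : Filter ℝ :=
  ⨆ (δ : ℝ) (_ : 0 < δ), atTop ⊓ 𝓟 (avoiding A δ)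

variable {A B : Finset ℝ} {a t δ : ℝ}

lemma tendsto_poleAvoiding {α : Type*} {f : ℝ → α} {F : Filter α} :
    Tendsto f (poleAvoiding A) F ↔ ∀ δ > 0, Tendsto f (atTop ⊓ 𝓟 (avoiding A δ)) F := by
  simp only [poleAvoiding, tendsto_iSup]

lemma poleAvoiding_anti (h : A ⊆ B) : poleAvoiding B ≤ poleAvoiding A :=
  iSup₂_mono fun _ _ => inf_le_inf_left _ <| principal_mono.2 fun _ hR a ha => hR a (h ha)

lemma le_abs_sub_intCast (hδ : δ ≤ t) (ht : t ≤ 1 - δ) (n : ℤ) : δ ≤ |t - n| := by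
  rcases le_or_gt n 0 with hn | hn
  · have : (n : ℝ) ≤ 0 := by exact_mod_cast hn
    exact le_abs.2 (.inl (by linarith))
  · have : (1 : ℝ) ≤ n := by exact_mod_cast hn
    exact le_abs.2 (.inr (by linarith))

-- The two values differ by `(j - i) * (h * a)`, which stays away from the integers.
lemma le_abs_or_le_abs {h R : ℝ} {i j N : ℕ} (ha : 0 < a) (hh : 0 < h) (hij : i < j) (hj : j ≤ N)
    (hδ : 2 * δ ≤ h * a) (hN : N * (h * a) ≤ 1 - 2 * δ) (m n : ℤ) :
    δ ≤ |(R + i * h) * a - m| ∨ δ ≤ |(R + j * h) * a - n| := by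
  have hha : 0 < h * a := mul_pos hh ha
  have hij' : (i : ℝ) + 1 ≤ j := by exact_mod_cast hij
  have hj' : (j : ℝ) ≤ N := by exact_mod_cast hj
  have : (0 : ℝ) ≤ i := i.cast_nonneg
  have hgap : 2 * δ ≤ |((j : ℝ) - i) * (h * a) - (n - m : ℤ)| :=
    le_abs_sub_intCast (by nlinarith) (by nlinarith) _
  by_contra! hcon
  have htri := abs_sub ((R + j * h) * a - n) ((R + i * h) * a - m)
  rw [show (R + j * h) * a - n - ((R + i * h) * a - m)
    = ((j : ℝ) - i) * (h * a) - (n - m : ℤ) by push_cast; ring] at htri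
  linarith

lemma exists_avoiding_ge (hA : ∀ a ∈ A, 0 < a) : ∃ δ > 0, ∀ R₀, ∃ R ≥ R₀, R ∈ avoiding A δ := by
  have hsmall : ∀ᶠ h : ℝ in 𝓝[>] 0, ∀ a ∈ A, A.card * (h * a) < 1 / 2 := by
    refine (Finset.eventually_all A).2 fun a _ => ?_
    have hlim : Tendsto (fun h : ℝ => A.card * (h * a)) (𝓝[>] 0) (𝓝 (A.card * (0 * a))) :=
      tendsto_nhdsWithin_of_tendsto_nhds (Continuous.tendsto (by fun_prop) 0)
    exact hlim.eventually_lt_const (by simp)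
  obtain ⟨h, hN, hh : 0 < h⟩ := (hsmall.and self_mem_nhdsWithin).exists
  have hδsmall : ∀ᶠ δ : ℝ in 𝓝[>] 0, δ < 1 / 4 ∧ ∀ a ∈ A, δ < h * a / 2 := by
    refine nhdsWithin_le_nhds ((eventually_lt_nhds (by norm_num)).and
      ((Finset.eventually_all A).2 fun a ha => eventually_lt_nhds ?_))
    have := hA a ha
    positivity
  obtain ⟨δ, ⟨hδ, hδa⟩, hδ0 : 0 < δ⟩ := (hδsmall.and self_mem_nhdsWithin).exists
  refine ⟨δ, hδ0, fun R₀ => ?_⟩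
  by_contra! hcon
  have hbad (j : ℕ) : ∃ a ∈ A, ∃ n : ℤ, |(R₀ + j * h) * a - n| < δ := by
    simpa [avoiding] using hcon (R₀ + j * h) (le_add_of_nonneg_right (by positivity))
  choose a ha n hn using hbad
  obtain ⟨i, hi, j, hj, hij, haij⟩ := Finset.exists_ne_map_eq_of_card_lt_of_maps_to
    (s := Finset.range (A.card + 1)) (t := A) (f := a) (by simp) fun j _ => ha j
  rw [Finset.mem_range, Nat.lt_succ_iff] at hi hj
  wlog hlt : i < j generalizing i j
  · exact this j hj i hi hij.symm haij.symm (by lia)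
  have hbound := hδa _ (ha j)
  have hbound' := hN _ (ha j)
  rcases le_abs_or_le_abs (δ := δ) (R := R₀) (hA _ (ha j)) hh hlt hj (by linarith) (by linarith)
    (n i) (n j) with h | h
  · exact h.not_gt (haij ▸ hn i)
  · exact h.not_gt (hn j)

lemma exists_neBot_avoiding (hA : ∀ a ∈ A, 0 < a) :
    ∃ δ > 0, (atTop ⊓ 𝓟 (avoiding A δ)).NeBot := by
  obtain ⟨δ, hδ, h⟩ := exists_avoiding_ge hA
  exact ⟨δ, hδ, inf_principal_neBot_iff.2 fun s hs =>
    have ⟨R₀, hR₀⟩ := mem_atTop_sets.1 hs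
    have ⟨R, hR, hRA⟩ := h R₀
    ⟨R, hR₀ R hR, hRA⟩⟩

end PoleAvoidance

section Vanishing

variable {A : Finset ℝ} {a c t L R T U δ η : ℝ} {s z : ℂ}

lemma cos_two_pi_mul_le (hδ : 0 ≤ δ) (h : ∀ n : ℤ, δ ≤ |t - n|) :
    Real.cos (2 * π * t) ≤ Real.cos (2 * π * δ) := by
  have hperiod : Real.cos (2 * π * t) = Real.cos (2 * π * |t - round t|) := by
    rw [← Real.cos_sub_int_mul_two_pi _ (round t), ← Real.cos_abs, ← abs_of_pos Real.two_pi_pos,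
      ← abs_mul, abs_of_pos Real.two_pi_pos]
    ring_nf
  have hround := abs_sub_round t
  rw [hperiod]
  refine Real.cos_le_cos_of_nonneg_of_le_pi (by positivity) ?_ ?_
  · nlinarith [Real.pi_pos]
  · exact mul_le_mul_of_nonneg_left (h _) Real.two_pi_pos.le

/-- `z` keeps away from `1`, by the margin `c`, both absolutely and relatively to its size. -/
def FarFromOne (c : ℝ) (z : ℂ) : Prop :=
  c ≤ ‖1 - z‖ ∧ c * ‖z‖ ≤ ‖1 - z‖

lemma farFromOne_one_sub {ρ : ℝ} (h0 : 0 ≤ ρ) (h1 : ρ ≤ 1) (h : z.re ≤ ρ * ‖z‖) :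
    FarFromOne (1 - ρ) z := by
  have hexpand : ‖1 - z‖ ^ 2 = 1 + ‖z‖ ^ 2 - 2 * z.re := by
    rw [← Complex.normSq_eq_norm_sq, ← Complex.normSq_eq_norm_sq, Complex.normSq_apply,
      Complex.normSq_apply]
    simp only [Complex.sub_re, Complex.one_re, Complex.sub_im, Complex.one_im]
    ring
  have hsq : (1 - ρ) * (1 + ‖z‖ ^ 2) ≤ ‖1 - z‖ ^ 2 := by
    rw [hexpand]
    nlinarith [mul_nonneg h0 (sq_nonneg (1 - ‖z‖))]
  have hρ : 0 ≤ ρ * (1 - ρ) := mul_nonneg h0 (by linarith)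
  constructor
  · refine abs_le_of_sq_le_sq' ?_ (norm_nonneg _) |>.2
    nlinarith [mul_nonneg (sub_nonneg.2 h1) (sq_nonneg ‖z‖)]
  · refine abs_le_of_sq_le_sq' ?_ (norm_nonneg _) |>.2
    nlinarith [mul_nonneg hρ (sq_nonneg ‖z‖)]

lemma farFromOne_half (h : ‖z‖ ≤ 1 / 2 ∨ 2 ≤ ‖z‖) : FarFromOne (1 / 2) z := by
  have h₁ := norm_sub_norm_le 1 z
  have h₂ := norm_sub_norm_le z 1
  rw [norm_sub_rev z 1] at h₂
  rw [norm_one] at h₁ h₂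
  rcases h with h | h <;> constructor <;> linarith

lemma norm_exp_neg_mul : ‖Complex.exp (-a * s)‖ = Real.exp (-(a * s.re)) := by
  rw [Complex.norm_exp, neg_mul, Complex.neg_re, Complex.re_ofReal_mul]

lemma norm_kernel_le (hc : 0 < c) (hη : η ≤ -L) (hη' : η ≤ L + ∑ a ∈ A, a)
    (h : ∀ a ∈ A, FarFromOne c (Complex.exp (-a * s))) :
    ‖kernel A L s‖ ≤ Real.exp (-(η * |s.re|)) * ((c ^ A.card)⁻¹ * ‖s‖⁻¹) := by
  have habs : c ^ A.card ≤ ∏ a ∈ A, ‖1 - Complex.exp (-a * s)‖ := by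
    rw [← Finset.prod_const]
    exact Finset.prod_le_prod (fun _ _ => hc.le) fun a ha => (h a ha).1
  have hrel : c ^ A.card * Real.exp (-((∑ a ∈ A, a) * s.re))
      ≤ ∏ a ∈ A, ‖1 - Complex.exp (-a * s)‖ := by
    rw [Finset.sum_mul, ← Finset.sum_neg_distrib, Real.exp_sum, ← Finset.prod_const,
      ← Finset.prod_mul_distrib]
    refine Finset.prod_le_prod (fun _ _ => by positivity) fun a ha => ?_
    rw [← norm_exp_neg_mul]
    exact (h a ha).2
  have hcn : 0 < c ^ A.card := pow_pos hc _
  rw [kernel, norm_div, norm_mul, norm_prod, Complex.norm_exp, Complex.re_ofReal_mul,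
    mul_comm ‖s‖, ← div_div, ← mul_assoc, ← div_eq_mul_inv, ← div_eq_mul_inv]
  refine div_le_div_of_nonneg_right ?_ (norm_nonneg s)
  rw [div_le_div_iff₀ (hcn.trans_le habs) hcn]
  rcases le_total 0 s.re with hs | hs
  · refine mul_le_mul (Real.exp_le_exp.2 ?_) habs hcn.le (Real.exp_pos _).le
    rw [abs_of_nonneg hs]
    nlinarith
  · refine le_trans ?_ (mul_le_mul_of_nonneg_left hrel (Real.exp_pos _).le)
    rw [mul_left_comm, ← Real.exp_add, mul_comm _ (c ^ A.card)]
    refine mul_le_mul_of_nonneg_left (Real.exp_le_exp.2 ?_) hcn.le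
    rw [abs_of_nonpos hs]
    nlinarith

lemma norm_kernel_horizontal_le (hδ : 0 < δ) (hδ' : δ ≤ 1 / 4) (hη : η ≤ -L)
    (hη' : η ≤ L + ∑ a ∈ A, a) (hR : 0 < R) (hRA : R ∈ avoiding A δ) (hs : |s.im| = 2 * π * R) :
    ‖kernel A L s‖ ≤ Real.exp (-(η * |s.re|))
      * (((1 - Real.cos (2 * π * δ)) ^ A.card)⁻¹ * (2 * π * R)⁻¹) := by
  have hcos : 0 ≤ Real.cos (2 * π * δ) :=
    Real.cos_nonneg_of_neg_pi_div_two_le_of_le (by nlinarith [Real.pi_pos])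
      (by nlinarith [Real.pi_pos])
  have hcos' : Real.cos (2 * π * δ) < 1 := by
    have := Real.cos_lt_cos_of_nonneg_of_le_pi (x := 0) le_rfl
      (by nlinarith [Real.pi_pos] : 2 * π * δ ≤ π) (by positivity)
    rwa [Real.cos_zero] at this
  have hfar : ∀ a ∈ A, FarFromOne (1 - Real.cos (2 * π * δ)) (Complex.exp (-a * s)) := by
    intro a ha
    refine farFromOne_one_sub hcos hcos'.le ?_
    have him : Real.cos (-a * s : ℂ).im = Real.cos (2 * π * (R * a)) := by
      rw [neg_mul, Complex.neg_im, Complex.im_ofReal_mul, Real.cos_neg]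
      rcases abs_eq (by positivity : 0 ≤ 2 * π * R) |>.1 hs with h | h <;> rw [h]
      · ring_nf
      · rw [← Real.cos_neg]
        ring_nf
    rw [Complex.exp_re, Complex.norm_exp, mul_comm, him]
    exact mul_le_mul_of_nonneg_right (cos_two_pi_mul_le hδ.le (hRA a ha)) (Real.exp_pos _).le
  refine (norm_kernel_le (sub_pos.2 hcos') hη hη' hfar).trans ?_
  have := sub_pos.2 hcos'
  gcongr
  exact hs ▸ Complex.abs_im_le_norm s

lemma norm_kernel_vertical_le (hη : η ≤ -L) (hη' : η ≤ L + ∑ a ∈ A, a) (hU : 0 < U)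
    (hUA : ∀ a ∈ A, Real.log 2 ≤ a * U) (hs : |s.re| = U) :
    ‖kernel A L s‖ ≤ Real.exp (-(η * U)) * (((1 / 2) ^ A.card)⁻¹ * U⁻¹) := by
  have hfar : ∀ a ∈ A, FarFromOne (1 / 2) (Complex.exp (-a * s)) := by
    intro a ha
    have hexp : 2 ≤ Real.exp (a * U) := by
      rw [← Real.exp_log two_pos]
      exact Real.exp_le_exp.2 (hUA a ha)
    refine farFromOne_half ?_
    rw [norm_exp_neg_mul]
    rcases abs_eq hU.le |>.1 hs with h | h <;> rw [h]
    · left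
      rw [Real.exp_neg, one_div]
      exact inv_anti₀ two_pos hexp
    · right
      rwa [mul_neg, neg_neg]
  refine (norm_kernel_le one_half_pos hη hη' hfar).trans ?_
  rw [hs]
  gcongr
  exact hs ▸ Complex.abs_re_le_norm s

lemma exp_neg_abs_le (y : ℝ) : Real.exp (-|y|) ≤ 2 * (1 + y ^ 2)⁻¹ := by
  have h := Real.quadratic_le_exp_of_nonneg (abs_nonneg y)
  rw [Real.exp_neg, ← div_eq_mul_inv, inv_le_comm₀ (Real.exp_pos _) (by positivity), inv_div]
  nlinarith [sq_abs y, abs_nonneg y]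

lemma exists_integral_exp_neg_abs_le (hη : 0 < η) : ∃ M : ℝ, ∀ U : ℝ, 0 ≤ U →
    ∫ x in (-U)..U, Real.exp (-(η * |x|)) ≤ M := by
  have hint : MeasureTheory.Integrable fun x : ℝ => 2 * (1 + (η * x) ^ 2)⁻¹ :=
    (integrable_inv_one_add_sq.comp_mul_left' hη.ne').const_mul 2
  refine ⟨∫ x : ℝ, 2 * (1 + (η * x) ^ 2)⁻¹, fun U hU => ?_⟩
  calc ∫ x in (-U)..U, Real.exp (-(η * |x|))
      ≤ ∫ x in (-U)..U, 2 * (1 + (η * x) ^ 2)⁻¹ := by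
        refine intervalIntegral.integral_mono (by linarith)
          (Continuous.intervalIntegrable (by fun_prop) _ _) hint.intervalIntegrable fun x => ?_
        simpa only [abs_mul, abs_of_pos hη] using exp_neg_abs_le (η * x)
    _ ≤ ∫ x : ℝ, 2 * (1 + (η * x) ^ 2)⁻¹ := by
        rw [intervalIntegral.integral_of_le (by linarith)]
        exact MeasureTheory.setIntegral_le_integral hint
          (Eventually.of_forall fun x => by positivity)

lemma norm_rectInt_le {f : ℂ → ℂ} {C D M : ℝ} (hU : 0 ≤ U) (hT : 0 ≤ T) (hC : 0 ≤ C)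
    (hM : ∫ x in (-U)..U, Real.exp (-(η * |x|)) ≤ M)
    (hor : ∀ s : ℂ, |s.im| = T → ‖f s‖ ≤ Real.exp (-(η * |s.re|)) * C)
    (ver : ∀ s : ℂ, |s.re| = U → ‖f s‖ ≤ D) :
    ‖rectInt f U T‖ ≤ 2 * (M * C) + 2 * (D * (2 * T)) := by
  have hhor {t : ℝ} (ht : |t| = T) : ‖∫ x : ℝ in (-U)..U, f (x + t * I)‖ ≤ M * C := by
    refine (intervalIntegral.norm_integral_le_of_norm_le (by linarith)
      (Eventually.of_forall fun x _ => (hor (x + t * I) (by simpa using ht)).trans_eq (by simp))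
      (Continuous.intervalIntegrable (by fun_prop : Continuous fun x => Real.exp (-(η * |x|)) * C)
        _ _)).trans ?_
    rw [intervalIntegral.integral_mul_const]
    exact mul_le_mul_of_nonneg_right hM hC
  have hver {u : ℝ} (hu : |u| = U) : ‖I * ∫ y : ℝ in (-T)..T, f (u + y * I)‖ ≤ D * (2 * T) := by
    rw [norm_mul, Complex.norm_I, one_mul]
    refine (intervalIntegral.norm_integral_le_of_norm_le_const fun y _ =>
      ver (u + y * I) (by simpa using hu)).trans_eq ?_
    rw [sub_neg_eq_add, ← two_mul, abs_of_nonneg (by positivity)]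
  have hbot := hhor (t := -T) (by rwa [abs_neg, abs_of_nonneg])
  have htop := hhor (abs_of_nonneg hT)
  have hright := hver (abs_of_nonneg hU)
  have hleft := hver (u := -U) (by rwa [abs_neg, abs_of_nonneg])
  rw [rectInt]
  linarith [norm_sub_le_of_le (norm_add_le_of_le (norm_sub_le_of_le hbot htop) hright) hleft]

lemma ne_intCast_of_mem_avoiding (hδ : 0 < δ) (hR : R ∈ avoiding A δ) :
    ∀ a ∈ A, ∀ n : ℤ, R * a ≠ n := fun a ha n h => by
  have := hR a ha n
  rw [h, sub_self, abs_zero] at this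
  exact this.not_gt hδ

lemma exists_abs_totalResidue_le (hA : Incommensurable A) (hL : L < 0) (hL' : -∑ a ∈ A, a < L)
    (hδ : 0 < δ) (hδ' : δ ≤ 1 / 4) :
    ∃ C : ℝ, ∀ R ∈ avoiding A δ, 0 < R → 2 * π * |totalResidue A L R| ≤ C * (2 * π * R)⁻¹ := by
  obtain ⟨η, hη0, hη⟩ := exists_between (lt_min (neg_pos.2 hL) (by linarith : 0 < L + ∑ a ∈ A, a))
  obtain ⟨hη₁, hη₂⟩ := lt_min_iff.1 hη
  obtain ⟨M, hM⟩ := exists_integral_exp_neg_abs_le hη0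
  set c := ((1 - Real.cos (2 * π * δ)) ^ A.card)⁻¹
  have hc : 0 ≤ c := inv_nonneg.2 (pow_nonneg (sub_nonneg.2 (Real.cos_le_one _)) _)
  refine ⟨2 * M * c, fun R hRA hR => ?_⟩
  have hT : 0 < 2 * π * R := mul_pos Real.two_pi_pos hR
  have hbig : ∀ᶠ U : ℝ in atTop, ∀ a ∈ A, Real.log 2 ≤ a * U :=
    (Finset.eventually_all A).2 fun a ha =>
      (tendsto_id.const_mul_atTop (hA.pos a ha)).eventually_ge_atTop _
  have hdecay : Tendsto (fun U : ℝ => Real.exp (-(η * U)) * (((1 / 2) ^ A.card)⁻¹ * U⁻¹)) atTop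
      (𝓝 0) := by
    simpa using (Real.tendsto_exp_neg_atTop_nhds_zero.comp (tendsto_id.const_mul_atTop hη0)).mul
      (tendsto_inv_atTop_zero.const_mul (((1 / 2 : ℝ) ^ A.card)⁻¹))
  have hlim := ((hdecay.mul_const (2 * (2 * π * R))).const_mul 2).const_add
    (2 * (M * (c * (2 * π * R)⁻¹)))
  rw [zero_mul, mul_zero, add_zero, ← mul_assoc, ← mul_assoc] at hlim
  refine ge_of_tendsto hlim ?_
  filter_upwards [hbig, eventually_gt_atTop 0] with U hUA hU
  have hbound := norm_rectInt_le (f := kernel A L) hU.le hT.le (by positivity) (hM U hU.le)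
    (fun s => norm_kernel_horizontal_le hδ hδ' hη₁.le hη₂.le hR hRA)
    (fun s => norm_kernel_vertical_le hη₁.le hη₂.le hU hUA)
  rw [rectInt_kernel hA hU hR (ne_intCast_of_mem_avoiding hδ hRA), norm_mul] at hbound
  have hnorm : ‖2 * π * I‖ * ‖(totalResidue A L R : ℂ)‖ = 2 * π * |totalResidue A L R| := by
    simp [abs_of_pos Real.pi_pos]
  rw [hnorm] at hbound
  linarith

lemma avoiding_anti {δ' : ℝ} (h : δ' ≤ δ) : avoiding A δ ⊆ avoiding A δ' :=
  fun _ hR a ha n => h.trans (hR a ha n)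

theorem tendsto_totalResidue_zero (hA : Incommensurable A) (hL : L < 0)
    (hL' : -∑ a ∈ A, a < L) : Tendsto (totalResidue A L) (poleAvoiding A) (𝓝 0) := by
  refine tendsto_poleAvoiding.2 fun δ hδ => ?_
  obtain ⟨C, hC⟩ := exists_abs_totalResidue_le hA hL hL' (lt_min hδ (by norm_num : (0 : ℝ) < 1 / 4))
    (min_le_right _ _)
  have hlim : Tendsto (fun R : ℝ => C * (2 * π * R)⁻¹) atTop (𝓝 0) := by
    simpa using (tendsto_inv_atTop_zero.comp
      (tendsto_id.const_mul_atTop Real.two_pi_pos)).const_mul C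
  have hprod : Tendsto (fun R => 2 * π * totalResidue A L R) (atTop ⊓ 𝓟 (avoiding A δ)) (𝓝 0) := by
    refine squeeze_zero_norm' ?_ (hlim.mono_left inf_le_left)
    filter_upwards [mem_inf_of_right (mem_principal_self _),
      mem_inf_of_left (eventually_gt_atTop 0)] with R hRA hR
    rw [norm_mul, Real.norm_of_nonneg Real.two_pi_pos.le]
    exact hC R (avoiding_anti (min_le_left _ _) hRA) hR
  simpa only [inv_mul_cancel_left₀ Real.two_pi_pos.ne', mul_zero]
    using hprod.const_mul (2 * π)⁻¹

end Vanishing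

section Counting

variable {A : Finset ℝ} {S T : Set ℝ} {a b c L : ℝ}

lemma induction_on_sub {P : ℝ → Prop} (hb : 0 < b) (base : ∀ L, c - b < L → L ≤ c → P L)
    (step : ∀ L, c < L → P (L - b) → P L) (hL : c - b < L) : P L := by
  obtain ⟨n, hn⟩ := Archimedean.arch (L - c) hb
  rw [nsmul_eq_mul] at hn
  induction n generalizing L with
  | zero => exact base L hL (by simpa using hn)
  | succ n ih =>
    rcases le_or_gt L c with h | h
    · exact base L hL h
    · refine step L h (ih (by linarith) ?_)
      push_cast at hn
      linarith

/-- The combinations of elements of `A` with natural coefficients, as multisets, whose value lies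
in `S`. -/
def combinations (A : Finset ℝ) (S : Set ℝ) : Set (Multiset ℝ) :=
  {m | (∀ a ∈ m, a ∈ A) ∧ m.sum ∈ S}

/-- The number of combinations of elements of `A` with natural coefficients whose value is at most
`L`, where those of value `L` count one half. -/
noncomputable def weightedCount (A : Finset ℝ) (L : ℝ) : ℝ :=
  ((combinations A (Set.Iic L)).ncard + (combinations A (Set.Iio L)).ncard) / 2

lemma combinations_mono (h : S ⊆ T) : combinations A S ⊆ combinations A T :=
  fun _ hm => ⟨hm.1, h hm.2⟩

lemma combinations_empty : combinations ∅ S = {m | m = 0 ∧ 0 ∈ S} := by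
  ext m
  constructor
  · rintro ⟨hm, hS⟩
    obtain rfl := Multiset.eq_zero_of_forall_notMem fun a ha => by simpa using hm a ha
    exact ⟨rfl, by simpa using hS⟩
  · rintro ⟨rfl, hS⟩
    exact ⟨by simp, by simpa using hS⟩

lemma combinations_Iic_of_neg (hA : ∀ a ∈ A, 0 < a) (hL : L < 0) :
    combinations A (Set.Iic L) = ∅ :=
  Set.eq_empty_of_forall_notMem fun _ hm =>
    (hL.trans_le (Multiset.sum_nonneg fun a ha => (hA a (hm.1 a ha)).le)).not_ge hm.2

lemma combinations_insert :
    combinations (insert b A) S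
      = combinations A S ∪ (b ::ₘ ·) '' combinations (insert b A) ((b + ·) ⁻¹' S) := by
  ext m
  constructor
  · rintro ⟨hm, hS⟩
    by_cases hb : b ∈ m
    · obtain ⟨m, rfl⟩ := Multiset.exists_cons_of_mem hb
      exact .inr ⟨m, ⟨fun a ha => hm a (Multiset.mem_cons_of_mem ha), by simpa using hS⟩, rfl⟩
    · exact .inl ⟨fun a ha => Finset.mem_of_mem_insert_of_ne (hm a ha) fun h => hb (h ▸ ha), hS⟩
  · rintro (⟨hm, hS⟩ | ⟨_, ⟨hm, hS⟩, rfl⟩)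
    · exact ⟨fun a ha => Finset.mem_insert_of_mem (hm a ha), hS⟩
    · exact ⟨by simpa using hm, by simpa using hS⟩

lemma finite_combinations_Iic (hA : ∀ a ∈ A, 0 < a) (L : ℝ) :
    (combinations A (Set.Iic L)).Finite := by
  induction A using Finset.induction_on generalizing L with
  | empty =>
    rw [combinations_empty]
    exact (Set.finite_singleton 0).subset fun _ hm => hm.1
  | insert b A _ ih =>
    obtain ⟨hb, hA'⟩ := (Finset.forall_mem_insert _ _ _).1 hA
    have hneg : ∀ L < 0, (combinations (insert b A) (Set.Iic L)).Finite := fun L hL => by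
      rw [combinations_Iic_of_neg hA hL]
      exact Set.finite_empty
    rcases lt_or_ge L 0 with hL | hL
    · exact hneg L hL
    refine induction_on_sub (c := -1) (P := fun L => (combinations (insert b A) (Set.Iic L)).Finite)
      hb (fun L _ h => hneg L (by linarith)) (fun L _ h => ?_)
      (by linarith)
    rw [combinations_insert, Set.preimage_const_add_Iic]
    exact (ih hA' L).union (h.image _)

lemma ncard_combinations_insert (hbA : b ∉ A) (h : (combinations (insert b A) S).Finite) :
    (combinations (insert b A) S).ncard
      = (combinations A S).ncard + (combinations (insert b A) ((b + ·) ⁻¹' S)).ncard := by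
  have hdisj : Disjoint (combinations A S)
      ((b ::ₘ ·) '' combinations (insert b A) ((b + ·) ⁻¹' S)) :=
    Set.disjoint_left.2 <| by
      rintro _ hm ⟨m, _, rfl⟩
      exact hbA (hm.1 b (Multiset.mem_cons_self b m))
  rw [combinations_insert] at h
  rw [combinations_insert, Set.ncard_union_eq hdisj (h.subset Set.subset_union_left)
    (h.subset Set.subset_union_right),
    Set.ncard_image_of_injective _ fun _ _ => (Multiset.cons_inj_right b).1]

lemma weightedCount_insert (hA : ∀ a ∈ insert b A, 0 < a) (hbA : b ∉ A) :
    weightedCount (insert b A) L = weightedCount (insert b A) (L - b) + weightedCount A L := by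
  have hfin := finite_combinations_Iic hA L
  rw [weightedCount, ncard_combinations_insert hbA hfin, Set.preimage_const_add_Iic,
    ncard_combinations_insert hbA (hfin.subset (combinations_mono Set.Iio_subset_Iic_self)),
    Set.preimage_const_add_Iio, weightedCount, weightedCount]
  push_cast
  ring

lemma weightedCount_eq_sub (hA : ∀ a ∈ A, 0 < a) :
    weightedCount A L
      = (combinations A (Set.Iic L)).ncard - 1 / 2 * (combinations A {L}).ncard := by
  have hfin := finite_combinations_Iic hA L
  have hunion : combinations A (Set.Iic L) = combinations A (Set.Iio L) ∪ combinations A {L} := by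
    ext m
    simp [combinations, le_iff_lt_or_eq, and_or_left]
  have hdisj : Disjoint (combinations A (Set.Iio L)) (combinations A {L}) :=
    Set.disjoint_left.2 fun _ hlt heq => hlt.2.ne heq.2
  rw [weightedCount, hunion, Set.ncard_union_eq hdisj
    (hfin.subset (combinations_mono Set.Iio_subset_Iic_self))
    (hfin.subset (combinations_mono (Set.singleton_subset_iff.2 Set.self_mem_Iic)))]
  push_cast
  ring

lemma weightedCount_of_neg (hA : ∀ a ∈ A, 0 < a) (hL : L < 0) : weightedCount A L = 0 := by
  have h := combinations_Iic_of_neg hA hL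
  rw [weightedCount, h, Set.subset_eq_empty (combinations_mono Set.Iio_subset_Iic_self) h]
  simp

lemma weightedCount_empty_of_pos (hL : 0 < L) : weightedCount ∅ L = 1 := by
  simp [weightedCount, combinations_empty, hL, hL.le]

lemma weightedCount_empty_zero : weightedCount ∅ 0 = 1 / 2 := by
  simp [weightedCount, combinations_empty]

lemma weightedCount_singleton_zero (ha : 0 < a) : weightedCount {a} 0 = 1 / 2 := by
  rw [← insert_empty_eq, weightedCount_insert (by simpa) (Finset.notMem_empty a),
    weightedCount_of_neg (by simpa) (by linarith), weightedCount_empty_zero, zero_add]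

lemma bernoulliStar_of_mem_Ioo (h : L ∈ Set.Ioo (-1) 0) : bernoulliStar L = L + 1 / 2 := by
  have hfloor : ⌊L⌋ = -1 := Int.floor_eq_iff.2 ⟨by simpa using h.1.le, by simpa using h.2⟩
  rw [bernoulliStar, if_neg, Int.fract, hfloor]
  · push_cast
    ring
  · rintro ⟨n, rfl⟩
    have h₁ : -1 < n := by exact_mod_cast h.1
    have h₂ : n < 0 := by exact_mod_cast h.2
    lia

lemma bernoulliStar_zero : bernoulliStar 0 = 0 :=
  if_pos ⟨0, Int.cast_zero⟩

lemma bernoulliStar_sub_one : bernoulliStar (L - 1) = bernoulliStar L := by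
  have h : (∃ n : ℤ, (n : ℝ) = L - 1) ↔ ∃ n : ℤ, (n : ℝ) = L :=
    ⟨fun ⟨n, hn⟩ => ⟨n + 1, by push_cast; linarith⟩, fun ⟨n, hn⟩ => ⟨n - 1, by push_cast; linarith⟩⟩
  rw [bernoulliStar, bernoulliStar, Int.fract_sub_one, propext h]

lemma weightedCount_singleton (ha : 0 < a) (hL : -a < L) :
    weightedCount {a} L = L / a + 1 / 2 - bernoulliStar (L / a) := by
  refine induction_on_sub (c := 0)
    (P := fun L => weightedCount {a} L = L / a + 1 / 2 - bernoulliStar (L / a))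
    ha (fun L hL hL0 => ?_) (fun L hL ih => ?_) (by linarith)
  · rcases hL0.eq_or_lt with rfl | hL0
    · rw [weightedCount_singleton_zero ha, zero_div, bernoulliStar_zero, zero_add, sub_zero]
    · have hmem : L / a ∈ Set.Ioo (-1) 0 :=
        ⟨(lt_div_iff₀ ha).2 (by linarith), div_neg_of_neg_of_pos hL0 ha⟩
      rw [weightedCount_of_neg (by simpa) hL0, bernoulliStar_of_mem_Ioo hmem, sub_self]
  · rw [← insert_empty_eq, weightedCount_insert (by simpa) (Finset.notMem_empty a),
      insert_empty_eq, ih, weightedCount_empty_of_pos hL, sub_div, div_self ha.ne',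
      bernoulliStar_sub_one]
    ring

lemma poleResidue_singleton_zero_re (k : ℤ) : (poleResidue {a} 0 a k).re = 0 := by
  have h : poleResidue {a} 0 a k = (pole a k * a)⁻¹ := by
    simp [poleResidue]
  rw [h, Complex.inv_re, Complex.mul_re, pole_re]
  simp

lemma totalResidue_singleton_zero (ha : a ≠ 0) (R : ℝ) : totalResidue {a} 0 R = 1 / 2 := by
  simp [totalResidue, poleResidue_singleton_zero_re, zeroResidue, coeff_toddSeries, ha]

theorem tendsto_totalResidue (hA : Incommensurable A) (hL : -∑ a ∈ A, a < L) :
    Tendsto (totalResidue A L) (poleAvoiding A) (𝓝 (weightedCount A L)) := by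
  induction A using Finset.induction_on generalizing L with
  | empty =>
    rw [Finset.sum_empty, neg_zero] at hL
    rw [weightedCount_empty_of_pos hL]
    exact tendsto_const_nhds.congr fun R => totalResidue_empty.symm
  | insert b A hbA ih =>
    have hA' := hA.mono (Finset.subset_insert b A)
    have hb := hA.pos b (Finset.mem_insert_self b A)
    have hsum : ∑ a ∈ insert b A, a = b + ∑ a ∈ A, a := Finset.sum_insert hbA
    refine induction_on_sub (c := -∑ a ∈ A, a) (P := fun L => Tendsto
      (totalResidue (insert b A) L) (poleAvoiding (insert b A)) (𝓝 (weightedCount (insert b A) L)))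
      hb (fun L hL hLA => ?_) (fun L hLA ihL => ?_) (by linarith)
    · have hA0 : 0 ≤ ∑ a ∈ A, a := Finset.sum_nonneg fun a ha => (hA'.pos a ha).le
      rcases lt_or_ge L 0 with hL0 | hL0
      · rw [weightedCount_of_neg hA.pos hL0]
        exact tendsto_totalResidue_zero hA hL0 (by linarith)
      · obtain rfl : A = ∅ := Finset.not_nonempty_iff_eq_empty.1 fun h =>
          (Finset.sum_pos hA'.pos h).not_ge (by linarith)
        obtain rfl : L = 0 := le_antisymm (by simpa using hLA) hL0
        rw [insert_empty_eq, weightedCount_singleton_zero hb]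
        exact tendsto_const_nhds.congr fun R => (totalResidue_singleton_zero hb.ne' R).symm
    · rw [weightedCount_insert hA.pos hbA]
      exact (ihL.add ((ih hA' hLA).mono_left (poleAvoiding_anti (Finset.subset_insert b A)))).congr
        fun R => (totalResidue_insert hA hbA).symm

end Counting

section SmoothNumbers

variable {S : Set ℝ} {a b c d x : ℝ} {p q : ℕ}

lemma irrational_log_div_log (hp : p.Prime) (hq : q.Prime) (hpq : p ≠ q) :
    Irrational (Real.log p / Real.log q) := by
  have hp1 : 0 < Real.log p := Real.log_pos (by exact_mod_cast hp.one_lt)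
  have hq1 : 0 < Real.log q := Real.log_pos (by exact_mod_cast hq.one_lt)
  rintro ⟨r, hr⟩
  have hr0 : 0 < r := by
    have : (0 : ℝ) < r := hr ▸ div_pos hp1 hq1
    exact_mod_cast this
  obtain ⟨n, hn⟩ := Int.eq_ofNat_of_zero_le (Rat.num_pos.2 hr0).le
  have hlog : Real.log ((p : ℝ) ^ r.den) = Real.log ((q : ℝ) ^ n) := by
    rw [Real.log_pow, Real.log_pow]
    have hrd : (r : ℝ) = n / r.den := by
      rw [Rat.cast_def, hn]
      simp
    have hden : (r.den : ℝ) ≠ 0 := by exact_mod_cast r.den_ne_zero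
    rw [hrd, div_eq_div_iff hden hq1.ne'] at hr
    linarith
  have hpow : p ^ r.den = q ^ n := by
    exact_mod_cast Real.log_injOn_pos (pow_pos (by exact_mod_cast hp.pos) _ : (0 : ℝ) < _)
      (pow_pos (by exact_mod_cast hq.pos) _ : (0 : ℝ) < _) hlog
  exact hpq ((Nat.prime_dvd_prime_iff_eq hp hq).1
    (hp.dvd_of_dvd_pow ((dvd_pow_self p r.den_ne_zero).trans hpow.dvd)))

lemma incommensurable_image_log {A : Finset ℕ} (hA : ∀ p ∈ A, p.Prime) :
    Incommensurable (A.image fun p : ℕ => Real.log p) := by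
  constructor
  · simp only [Finset.forall_mem_image]
    exact fun p hp => Real.log_pos (by exact_mod_cast (hA p hp).one_lt)
  · simp only [Finset.forall_mem_image]
    exact fun p hp q hq hpq => irrational_log_div_log (hA p hp) (hA q hq) fun h => hpq (by rw [h])

lemma incommensurable_logs :
    Incommensurable {Real.log 2, Real.log 3, Real.log 5, Real.log 7} := by
  have h := incommensurable_image_log (A := {2, 3, 5, 7}) (by simp; norm_num)
  simpa only [Finset.image_insert, Finset.image_singleton, Nat.cast_ofNat] using h

lemma nodup_logs : [Real.log 2, Real.log 3, Real.log 5, Real.log 7].Nodup := by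
  have h : [(2 : ℝ), 3, 5, 7].Nodup := by norm_num
  refine List.Nodup.map_on (f := Real.log) (fun x hx y hy hxy => ?_) h
  have hpos : ∀ x ∈ [(2 : ℝ), 3, 5, 7], x ∈ Set.Ioi 0 := by simp
  exact Real.log_injOn_pos (hpos x hx) (hpos y hy) hxy

lemma sum_of_mem_combinations {m : Multiset ℝ} (h : [a, b, c, d].Nodup)
    (hm : m ∈ combinations {a, b, c, d} S) :
    m.sum = m.count a * a + m.count b * b + m.count c * c + m.count d * d := by
  simp only [List.nodup_cons, List.mem_cons, List.not_mem_nil, or_false, not_or] at h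
  have hsub : m.toFinset ⊆ {a, b, c, d} := fun x hx => hm.1 x (Multiset.mem_toFinset.1 hx)
  rw [Finset.sum_multiset_count_of_subset m _ hsub, Finset.sum_insert (by simp [h]),
    Finset.sum_insert (by simp [h]), Finset.sum_insert (by simp [h]), Finset.sum_singleton]
  simp only [nsmul_eq_mul, add_assoc]

lemma ncard_combinations_four (h : [a, b, c, d].Nodup) :
    (combinations {a, b, c, d} S).ncard
      = {e : ℕ × ℕ × ℕ × ℕ | e.1 * a + e.2.1 * b + e.2.2.1 * c + e.2.2.2 * d ∈ S}.ncard := by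
  refine Set.ncard_congr (fun m _ => (m.count a, m.count b, m.count c, m.count d))
    (fun m hm => ?_) (fun m n hm hn hmn => ?_) fun e he => ?_
  · rw [Set.mem_ofPred_eq, ← sum_of_mem_combinations h hm]
    exact hm.2
  · simp only [Prod.mk.injEq] at hmn
    ext x
    by_cases hx : x ∈ ({a, b, c, d} : Finset ℝ)
    · simp only [Finset.mem_insert, Finset.mem_singleton] at hx
      rcases hx with rfl | rfl | rfl | rfl <;> simp only [hmn]
    · rw [Multiset.count_eq_zero_of_notMem fun h => hx (hm.1 x h),
        Multiset.count_eq_zero_of_notMem fun h => hx (hn.1 x h)]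
  · refine ⟨.replicate e.1 a + .replicate e.2.1 b + .replicate e.2.2.1 c + .replicate e.2.2.2 d,
      ⟨fun x hx => ?_, by simpa using he⟩, ?_⟩
    · simp only [Multiset.mem_add, Multiset.mem_replicate] at hx
      simp only [Finset.mem_insert, Finset.mem_singleton]
      tauto
    · simp only [List.nodup_cons, List.mem_cons, List.not_mem_nil, or_false, not_or] at h
      simp [Multiset.count_replicate, h, eq_comm]

/-- The `7`-smooth number with the given exponents. -/
def smoothNumber (e : ℕ × ℕ × ℕ × ℕ) : ℕ :=
  2 ^ e.1 * 3 ^ e.2.1 * 5 ^ e.2.2.1 * 7 ^ e.2.2.2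

lemma smoothNumber_pos (e : ℕ × ℕ × ℕ × ℕ) : 0 < smoothNumber e := by
  unfold smoothNumber
  positivity

lemma factorization_smoothNumber (e : ℕ × ℕ × ℕ × ℕ) :
    (smoothNumber e).factorization = Finsupp.single 2 e.1 + Finsupp.single 3 e.2.1
      + Finsupp.single 5 e.2.2.1 + Finsupp.single 7 e.2.2.2 := by
  rw [smoothNumber, Nat.factorization_mul (by positivity) (by positivity),
    Nat.factorization_mul (by positivity) (by positivity),
    Nat.factorization_mul (by positivity) (by positivity),
    Nat.prime_two.factorization_pow, Nat.prime_three.factorization_pow,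
    Nat.prime_five.factorization_pow, Nat.prime_seven.factorization_pow]

lemma smoothNumber_injective : Function.Injective smoothNumber := by
  intro e e' h
  have hfac := congrArg Nat.factorization h
  rw [factorization_smoothNumber, factorization_smoothNumber] at hfac
  have h₂ := DFunLike.congr_fun hfac 2
  have h₃ := DFunLike.congr_fun hfac 3
  have h₅ := DFunLike.congr_fun hfac 5
  have h₇ := DFunLike.congr_fun hfac 7
  simp at h₂ h₃ h₅ h₇
  simp [Prod.ext_iff, h₂, h₃, h₅, h₇]

lemma log_smoothNumber (e : ℕ × ℕ × ℕ × ℕ) :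
    Real.log (smoothNumber e) = e.1 * Real.log 2 + e.2.1 * Real.log 3 + e.2.2.1 * Real.log 5
      + e.2.2.2 * Real.log 7 := by
  rw [smoothNumber]
  push_cast
  rw [Real.log_mul (by positivity) (by positivity), Real.log_mul (by positivity) (by positivity),
    Real.log_mul (by positivity) (by positivity), Real.log_pow, Real.log_pow, Real.log_pow,
    Real.log_pow]

lemma ncard_combinations_logs_Iic (hx : 0 < x) :
    (combinations {Real.log 2, Real.log 3, Real.log 5, Real.log 7} (Set.Iic (Real.log x))).ncard
      = sevenSmoothCount x := by
  rw [ncard_combinations_four nodup_logs, sevenSmoothCount]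
  congr 1
  ext e
  rw [Set.mem_ofPred_eq, Set.mem_ofPred_eq, ← log_smoothNumber, Set.mem_Iic,
    Real.log_le_log_iff (by exact_mod_cast smoothNumber_pos e) hx, smoothNumber]
  push_cast
  rfl

lemma ncard_combinations_logs_singleton (hx : 0 < x) :
    ((combinations {Real.log 2, Real.log 3, Real.log 5, Real.log 7} {Real.log x}).ncard : ℝ)
      = sevenSmoothChar x := by
  have hset : {e : ℕ × ℕ × ℕ × ℕ | e.1 * Real.log 2 + e.2.1 * Real.log 3 + e.2.2.1 * Real.log 5
      + e.2.2.2 * Real.log 7 ∈ ({Real.log x} : Set ℝ)} = {e | (smoothNumber e : ℝ) = x} := by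
    ext e
    have he : (0 : ℝ) < smoothNumber e := by exact_mod_cast smoothNumber_pos e
    rw [Set.mem_ofPred_eq, Set.mem_ofPred_eq, ← log_smoothNumber, Set.mem_singleton_iff,
      Real.log_injOn_pos.eq_iff he hx]
  rw [ncard_combinations_four nodup_logs, hset, sevenSmoothChar]
  by_cases h : x ∈ sevenSmoothSet
  · obtain ⟨p, q, l, f, rfl⟩ := id h
    rw [Set.indicator_of_mem h, Nat.cast_eq_one, Set.ncard_eq_one]
    refine ⟨(p, q, l, f), Set.ext fun e => ?_⟩
    rw [Set.mem_ofPred_eq, Set.mem_singleton_iff, ← smoothNumber_injective.eq_iff]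
    simp only [smoothNumber]
    exact_mod_cast Iff.rfl
  · rw [Set.indicator_of_notMem h, Nat.cast_eq_zero]
    have hempty : {e | (smoothNumber e : ℝ) = x} = ∅ :=
      Set.eq_empty_of_forall_notMem fun e he => h ⟨e.1, e.2.1, e.2.2.1, e.2.2.2, by
        rw [← he, smoothNumber]
        push_cast
        rfl⟩
    rw [hempty, Set.ncard_empty]

lemma weightedCount_logs (hx : 0 < x) :
    weightedCount {Real.log 2, Real.log 3, Real.log 5, Real.log 7} (Real.log x)
      = sevenSmoothCount x - 1 / 2 * sevenSmoothChar x := by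
  rw [weightedCount_eq_sub incommensurable_logs.pos, ncard_combinations_logs_Iic hx,
    ncard_combinations_logs_singleton hx]

end SmoothNumbers

section ResidueSums

/-- The partial sum with parameter `R` of the Fourier series of the sawtooth function at `L / a`. -/
noncomputable def sawSum (a L R : ℝ) : ℝ :=
  ∑ k ∈ Finset.Icc 1 ⌊R * a⌋₊, Real.sin (2 * π * k * (L / a)) / k

/-- The part with base `a` of `pairSum`, in terms of logarithms. -/
noncomputable def halfPairSum (a b L R : ℝ) : ℝ :=
  ∑ k ∈ Finset.Icc 1 ⌊R * a⌋₊,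
    Real.cos (2 * π * k * ((L - 1 / 2 * b) / a)) / (k * Real.sin (π * k * b / a))

/-- The sum `sineSum`, in terms of logarithms. -/
noncomputable def logSineSum (a b c L R : ℝ) : ℝ :=
  ∑ k ∈ Finset.Icc 1 ⌊R * a⌋₊,
    (Real.sin (2 * π * k * ((L + 1 / 2 * b - 1 / 2 * c) / a))
        / (k * Real.sin (π * k * b / a) * Real.sin (π * k * c / a))
      + Real.sin (2 * π * k * ((L - 1 / 2 * b + 1 / 2 * c) / a))
        / (k * Real.sin (π * k * b / a) * Real.sin (π * k * c / a)))

/-- The sum `cosineSum`, in terms of logarithms. -/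
noncomputable def logCosineSum (a b c d L R : ℝ) : ℝ :=
  ∑ k ∈ Finset.Icc 1 ⌊R * a⌋₊,
    Real.cos (π * k * b / a) * Real.cos (π * k * c / a) * Real.cos (π * k * d / a)
        * Real.cos (2 * π * k * (L / a))
      / (k * Real.sin (π * k * b / a) * Real.sin (π * k * c / a) * Real.sin (π * k * d / a))

variable {A : Finset ℝ} {a b c d L R φ ψ θ : ℝ} {k : ℕ}

lemma cos_sub_div_sin (hφ : Real.sin φ ≠ 0) :
    Real.cos (θ - φ) / (k * Real.sin φ) = (Real.cos θ * Real.cot φ + Real.sin θ) / k := by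
  rw [Real.cos_sub, Real.cot_eq_cos_div_sin]
  field_simp

lemma sin_add_sin_div_sin_mul_sin (hφ : Real.sin φ ≠ 0) (hψ : Real.sin ψ ≠ 0) :
    Real.sin (θ + (φ - ψ)) / (k * Real.sin φ * Real.sin ψ)
        + Real.sin (θ - (φ - ψ)) / (k * Real.sin φ * Real.sin ψ)
      = 2 * (Real.sin θ * (Real.cot φ * Real.cot ψ + 1)) / k := by
  rw [Real.sin_sub, Real.sin_add, Real.cos_sub, Real.cot_eq_cos_div_sin, Real.cot_eq_cos_div_sin]
  field_simp
  ring

lemma sin_pi_mul_div_ne_zero (h : Irrational (a / b)) (hk : k ≠ 0) :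
    Real.sin (π * k * b / a) ≠ 0 := by
  rw [Ne, Real.sin_eq_zero_iff]
  rintro ⟨n, hn⟩
  have hba : Irrational (k * (b / a)) := by
    rw [← inv_div a b]
    exact h.inv.natCast_mul hk
  refine hba.ne_int n (mul_left_cancel₀ Real.pi_ne_zero ?_)
  linear_combination -hn

lemma halfPairSum_eq (hab : Irrational (a / b)) :
    halfPairSum a b L R = ∑ k ∈ Finset.Icc 1 ⌊R * a⌋₊,
      (Real.cos (2 * π * k * (L / a)) * Real.cot (π * k * b / a)
        + Real.sin (2 * π * k * (L / a))) / k := by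
  refine Finset.sum_congr rfl fun k hk => ?_
  have hk0 : k ≠ 0 := Nat.one_le_iff_ne_zero.1 (Finset.mem_Icc.1 hk).1
  rw [← cos_sub_div_sin (sin_pi_mul_div_ne_zero hab hk0)]
  ring_nf

lemma logSineSum_eq (hab : Irrational (a / b)) (hac : Irrational (a / c)) :
    logSineSum a b c L R = ∑ k ∈ Finset.Icc 1 ⌊R * a⌋₊,
      2 * (Real.sin (2 * π * k * (L / a))
        * (Real.cot (π * k * b / a) * Real.cot (π * k * c / a) + 1)) / k := by
  refine Finset.sum_congr rfl fun k hk => ?_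
  have hk0 : k ≠ 0 := Nat.one_le_iff_ne_zero.1 (Finset.mem_Icc.1 hk).1
  rw [← sin_add_sin_div_sin_mul_sin (sin_pi_mul_div_ne_zero hab hk0)
    (sin_pi_mul_div_ne_zero hac hk0)]
  ring_nf

lemma logCosineSum_eq :
    logCosineSum a b c d L R = ∑ k ∈ Finset.Icc 1 ⌊R * a⌋₊,
      Real.cos (2 * π * k * (L / a)) * (Real.cot (π * k * b / a) * Real.cot (π * k * c / a)
        * Real.cot (π * k * d / a)) / k := by
  refine Finset.sum_congr rfl fun k _ => ?_
  simp only [Real.cot_eq_cos_div_sin, div_eq_mul_inv, mul_inv]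
  ring

lemma inv_one_sub_exp (hφ : Real.sin φ ≠ 0) :
    (1 - Complex.exp (-(2 * φ * I)))⁻¹ = (1 - Real.cot φ * I) / 2 := by
  have hφ' : Complex.sin φ ≠ 0 := by exact_mod_cast hφ
  have hsq : Complex.exp (-(2 * φ * I)) = (Complex.cos φ - Complex.sin φ * I) ^ 2 := by
    have h : Complex.cos φ - Complex.sin φ * I = Complex.exp (-φ * I) := by
      rw [Complex.exp_mul_I, Complex.cos_neg, Complex.sin_neg]
      ring
    rw [h, ← Complex.exp_nat_mul]
    congr 1
    push_cast
    ring
  refine inv_eq_of_mul_eq_one_right ?_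
  have hfactor : 1 - (Complex.cos φ - Complex.sin φ * I) ^ 2
      = 2 * Complex.sin φ * (Complex.sin φ + Complex.cos φ * I) := by
    linear_combination -Complex.sin_sq_add_cos_sq φ - Complex.sin φ ^ 2 * Complex.I_sq
  rw [hsq, hfactor, Complex.ofReal_cot, Complex.cot_eq_cos_div_sin]
  field_simp
  linear_combination Complex.sin_sq_add_cos_sq φ - Complex.cos φ ^ 2 * Complex.I_sq

lemma Incommensurable.irrational_div_of_mem_erase (hA : Incommensurable A) (ha : a ∈ A)
    (hb : b ∈ A.erase a) : Irrational (a / b) :=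
  hA.irrational_div a ha b (Finset.mem_of_mem_erase hb) (Finset.ne_of_mem_erase hb).symm

lemma two_mul_poleResidue (hA : Incommensurable A) (ha : a ∈ A) (hk : k ≠ 0) :
    2 * poleResidue A L a k
      = (π * k : ℝ)⁻¹ * ((Real.sin (2 * π * k * (L / a)) - Real.cos (2 * π * k * (L / a)) * I)
        * ∏ b ∈ A.erase a, (1 - Real.cot (π * k * b / a) * I) / 2) := by
  have ha0 : (a : ℂ) ≠ 0 := by exact_mod_cast (hA.pos a ha).ne'
  have hk0 : (k : ℂ) ≠ 0 := by exact_mod_cast hk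
  have hπ : (π : ℂ) ≠ 0 := by exact_mod_cast Real.pi_ne_zero
  have hprod : ∏ b ∈ A.erase a, (1 - Complex.exp (-b * pole a k))⁻¹
      = ∏ b ∈ A.erase a, (1 - Real.cot (π * k * b / a) * I) / 2 := by
    refine Finset.prod_congr rfl fun b hb => ?_
    rw [← inv_one_sub_exp (sin_pi_mul_div_ne_zero (hA.irrational_div_of_mem_erase ha hb) hk), pole]
    push_cast
    ring_nf
  have hexp : Complex.exp (L * pole a k)
      = Real.cos (2 * π * k * (L / a)) + Real.sin (2 * π * k * (L / a)) * I := by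
    rw [Complex.ofReal_cos, Complex.ofReal_sin, ← Complex.exp_mul_I, pole]
    push_cast
    ring_nf
  rw [poleResidue, ← hprod, Finset.prod_inv_distrib, hexp, pole]
  push_cast
  field_simp
  ring_nf
  simp only [Complex.I_sq]
  ring

lemma sum_two_mul_re_poleResidue (hA : Incommensurable A) (ha : a ∈ A) :
    ∑ k ∈ Finset.Icc 1 ⌊R * a⌋₊, 2 * (poleResidue A L a k).re
      = (∑ k ∈ Finset.Icc 1 ⌊R * a⌋₊,
        ((Real.sin (2 * π * k * (L / a)) - Real.cos (2 * π * k * (L / a)) * I)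
          * ∏ b ∈ A.erase a, (1 - Real.cot (π * k * b / a) * I) / 2).re / k) / π := by
  rw [Finset.sum_div]
  refine Finset.sum_congr rfl fun k hk => ?_
  have hk0 : k ≠ 0 := Nat.one_le_iff_ne_zero.1 (Finset.mem_Icc.1 hk).1
  have h := congrArg Complex.re (two_mul_poleResidue (L := L) hA ha hk0)
  rw [Complex.re_ofReal_mul] at h
  rw [div_div, mul_comm (k : ℝ), div_eq_inv_mul, ← h, ← Complex.re_ofReal_mul, Complex.ofReal_ofNat]

lemma sum_poleResidue_of_erase_eq_empty (hA : Incommensurable A) (ha : a ∈ A)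
    (h : A.erase a = ∅) :
    ∑ k ∈ Finset.Icc 1 ⌊R * a⌋₊, 2 * (poleResidue A L a k).re = sawSum a L R / π := by
  simp only [sum_two_mul_re_poleResidue hA ha, h, sawSum, Finset.prod_empty, mul_one,
    Complex.sub_re, Complex.ofReal_re, Complex.re_ofReal_mul, Complex.I_re, mul_zero, sub_zero]

lemma sum_poleResidue_of_erase_eq_singleton (hA : Incommensurable A) (ha : a ∈ A)
    (h : A.erase a = {b}) :
    ∑ k ∈ Finset.Icc 1 ⌊R * a⌋₊, 2 * (poleResidue A L a k).re
      = (2 * sawSum a L R - halfPairSum a b L R) / (2 * π) := by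
  have hab : Irrational (a / b) := hA.irrational_div_of_mem_erase ha (by simp [h])
  rw [sum_two_mul_re_poleResidue hA ha, h, sawSum, halfPairSum_eq hab, ← div_div]
  simp only [← Finset.sum_sub_distrib, Finset.mul_sum, Finset.sum_div]
  refine Finset.sum_congr rfl fun k _ => ?_
  simp only [Finset.prod_singleton, Complex.mul_re, Complex.mul_im, Complex.sub_re, Complex.sub_im,
    Complex.div_ofNat_re, Complex.div_ofNat_im, Complex.ofReal_re, Complex.ofReal_im, Complex.I_re,
    Complex.I_im, Complex.one_re, Complex.one_im]
  ring

lemma sum_poleResidue_of_erase_eq_pair (hA : Incommensurable A) (ha : a ∈ A)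
    (hbc : b ≠ c) (h : A.erase a = {b, c}) :
    ∑ k ∈ Finset.Icc 1 ⌊R * a⌋₊, 2 * (poleResidue A L a k).re
      = (4 * sawSum a L R - 1 / 2 * logSineSum a b c L R
        - halfPairSum a b L R - halfPairSum a c L R) / (4 * π) := by
  have hab : Irrational (a / b) := hA.irrational_div_of_mem_erase ha (by simp [h])
  have hac : Irrational (a / c) := hA.irrational_div_of_mem_erase ha (by simp [h])
  rw [sum_two_mul_re_poleResidue hA ha, h, sawSum, halfPairSum_eq hab, halfPairSum_eq hac,
    logSineSum_eq hab hac, ← div_div]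
  simp only [← Finset.sum_sub_distrib, Finset.mul_sum, Finset.sum_div]
  refine Finset.sum_congr rfl fun k _ => ?_
  rw [Finset.prod_pair hbc]
  simp only [Complex.mul_re, Complex.mul_im, Complex.sub_re, Complex.sub_im,
    Complex.div_ofNat_re, Complex.div_ofNat_im, Complex.ofReal_re, Complex.ofReal_im, Complex.I_re,
    Complex.I_im, Complex.one_re, Complex.one_im]
  ring

lemma sum_poleResidue_of_erase_eq_triple (hA : Incommensurable A) (ha : a ∈ A)
    (hbc : b ≠ c) (hbd : b ≠ d) (hcd : c ≠ d) (h : A.erase a = {b, c, d}) :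
    ∑ k ∈ Finset.Icc 1 ⌊R * a⌋₊, 2 * (poleResidue A L a k).re
      = (7 * sawSum a L R
        - 1 / 2 * (logSineSum a b c L R + logSineSum a b d L R + logSineSum a c d L R)
        - halfPairSum a b L R - halfPairSum a c L R - halfPairSum a d L R
        + logCosineSum a b c d L R) / (8 * π) := by
  have hab : Irrational (a / b) := hA.irrational_div_of_mem_erase ha (by simp [h])
  have hac : Irrational (a / c) := hA.irrational_div_of_mem_erase ha (by simp [h])
  have had : Irrational (a / d) := hA.irrational_div_of_mem_erase ha (by simp [h])
  rw [sum_two_mul_re_poleResidue hA ha, h, sawSum, halfPairSum_eq hab, halfPairSum_eq hac,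
    halfPairSum_eq had, logSineSum_eq hab hac, logSineSum_eq hab had, logSineSum_eq hac had,
    logCosineSum_eq, ← div_div]
  simp only [← Finset.sum_add_distrib, ← Finset.sum_sub_distrib, Finset.mul_sum, Finset.sum_div]
  refine Finset.sum_congr rfl fun k _ => ?_
  rw [Finset.prod_insert (by simp [hbc, hbd]), Finset.prod_pair hcd]
  simp only [Complex.mul_re, Complex.mul_im, Complex.sub_re, Complex.sub_im,
    Complex.div_ofNat_re, Complex.div_ofNat_im, Complex.ofReal_re, Complex.ofReal_im, Complex.I_re,
    Complex.I_im, Complex.one_re, Complex.one_im]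
  ring

/-- The partial sums attached to the unordered pair `a, b`; it is `pairSum` in terms of
logarithms. -/
noncomputable def logPairTotal (a b L R : ℝ) : ℝ :=
  halfPairSum a b L R + halfPairSum b a L R

/-- The partial sums of the sine series attached to the unordered triple `a, b, c`. -/
noncomputable def logSineTotal (a b c L R : ℝ) : ℝ :=
  logSineSum a b c L R + logSineSum b a c L R + logSineSum c a b L R

/-- The partial sums of the cosine series attached to the unordered quadruple `a, b, c, d`. -/
noncomputable def logCosineTotal (a b c d L R : ℝ) : ℝ :=
  logCosineSum a b c d L R + logCosineSum b a c d L R + logCosineSum c a b d L R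
    + logCosineSum d a b c L R

lemma totalResidue_singleton (ha : 0 < a) :
    totalResidue {a} L R = zeroResidue {a} L + sawSum a L R / π := by
  have hA : Incommensurable {a} := ⟨by simpa, by simp⟩
  rw [totalResidue, Finset.sum_singleton,
    sum_poleResidue_of_erase_eq_empty hA (Finset.mem_singleton_self a) (Finset.erase_singleton a)]

lemma totalResidue_pair (hA : Incommensurable {a, b}) (hab : a ≠ b) :
    totalResidue {a, b} L R = zeroResidue {a, b} L
      + (2 * (sawSum a L R + sawSum b L R) - logPairTotal a b L R) / (2 * π) := by
  rw [totalResidue, Finset.sum_pair hab,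
    sum_poleResidue_of_erase_eq_singleton hA (b := b) (by simp) (by grind),
    sum_poleResidue_of_erase_eq_singleton hA (b := a) (by simp) (by grind), logPairTotal]
  ring

lemma totalResidue_triple (hA : Incommensurable {a, b, c}) (h : [a, b, c].Nodup) :
    totalResidue {a, b, c} L R = zeroResidue {a, b, c} L
      + (4 * (sawSum a L R + sawSum b L R + sawSum c L R) - 1 / 2 * logSineTotal a b c L R
        - logPairTotal a b L R - logPairTotal a c L R - logPairTotal b c L R) / (4 * π) := by
  obtain ⟨⟨hab, hac⟩, hbc⟩ : (a ≠ b ∧ a ≠ c) ∧ b ≠ c := by simpa using h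
  rw [totalResidue, Finset.sum_insert (by simp [hab, hac]), Finset.sum_pair hbc,
    sum_poleResidue_of_erase_eq_pair hA (b := b) (c := c) (by simp) hbc (by grind),
    sum_poleResidue_of_erase_eq_pair hA (b := a) (c := c) (by simp) hac (by grind),
    sum_poleResidue_of_erase_eq_pair hA (b := a) (c := b) (by simp) hab (by grind),
    logPairTotal, logPairTotal, logPairTotal, logSineTotal]
  ring

lemma totalResidue_quadruple (hA : Incommensurable {a, b, c, d}) (h : [a, b, c, d].Nodup) :
    totalResidue {a, b, c, d} L R = zeroResidue {a, b, c, d} L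
      + (7 * (sawSum a L R + sawSum b L R + sawSum c L R + sawSum d L R)
        - 1 / 2 * (logSineTotal a b c L R + logSineTotal a b d L R + logSineTotal a c d L R
          + logSineTotal b c d L R)
        - logPairTotal a b L R - logPairTotal a c L R - logPairTotal a d L R
        - logPairTotal b c L R - logPairTotal b d L R - logPairTotal c d L R
        + logCosineTotal a b c d L R) / (8 * π) := by
  obtain ⟨⟨hab, hac, had⟩, ⟨hbc, hbd⟩, hcd⟩ :
      (a ≠ b ∧ a ≠ c ∧ a ≠ d) ∧ (b ≠ c ∧ b ≠ d) ∧ c ≠ d := by simpa using h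
  rw [totalResidue, Finset.sum_insert (by simp [hab, hac, had]),
    Finset.sum_insert (by simp [hbc, hbd]), Finset.sum_pair hcd,
    sum_poleResidue_of_erase_eq_triple hA (b := b) (c := c) (d := d) (by simp) hbc hbd hcd
      (by grind),
    sum_poleResidue_of_erase_eq_triple hA (b := a) (c := c) (d := d) (by simp) hac had hcd
      (by grind),
    sum_poleResidue_of_erase_eq_triple hA (b := a) (c := b) (d := d) (by simp) hab had hbd
      (by grind),
    sum_poleResidue_of_erase_eq_triple hA (b := a) (c := b) (d := c) (by simp) hab hac hbc
      (by grind)]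
  simp only [logPairTotal, logSineTotal, logCosineTotal]
  ring

end ResidueSums

section Limits

variable {A B : Finset ℝ} {a b c d L : ℝ}

lemma coeff_rescale_exp_mul (f : ℝ⟦X⟧) (n : ℕ) :
    PowerSeries.coeff n (PowerSeries.rescale L (PowerSeries.exp ℝ) * f)
      = ∑ k ∈ Finset.range (n + 1), L ^ k / k.factorial * PowerSeries.coeff (n - k) f := by
  rw [PowerSeries.coeff_mul, Finset.Nat.sum_antidiagonal_eq_sum_range_succ_mk]
  simp [PowerSeries.coeff_exp, div_eq_mul_inv]

lemma coeff_toddSeries_mul (f : ℝ⟦X⟧) (n : ℕ) :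
    PowerSeries.coeff n (toddSeries a * f) = ∑ k ∈ Finset.range (n + 1),
      a⁻¹ * (a ^ k * (bernoulli' k / k.factorial)) * PowerSeries.coeff (n - k) f := by
  simp only [PowerSeries.coeff_mul, Finset.Nat.sum_antidiagonal_eq_sum_range_succ_mk,
    coeff_toddSeries]

lemma zeroResidue_singleton (ha : a ≠ 0) : zeroResidue {a} L = L / a + 1 / 2 := by
  rw [zeroResidue, Finset.prod_singleton, Finset.card_singleton, coeff_rescale_exp_mul]
  simp only [Finset.sum_range_succ, Finset.sum_range_zero, coeff_toddSeries, bernoulli'_zero,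
    bernoulli'_one, Nat.factorial, Nat.sub_zero, Nat.sub_self]
  push_cast
  field_simp
  ring

lemma zeroResidue_quadruple (hA : ∀ p ∈ ({a, b, c, d} : Finset ℝ), p ≠ 0)
    (h : [a, b, c, d].Nodup) : zeroResidue {a, b, c, d} L = polyPart a b c d L := by
  obtain ⟨⟨hab, hac, had⟩, ⟨hbc, hbd⟩, hcd⟩ :
      (a ≠ b ∧ a ≠ c ∧ a ≠ d) ∧ (b ≠ c ∧ b ≠ d) ∧ c ≠ d := by simpa using h
  obtain ⟨ha, hb, hc, hd⟩ : a ≠ 0 ∧ b ≠ 0 ∧ c ≠ 0 ∧ d ≠ 0 := by simpa using hA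
  have hcard : ({a, b, c, d} : Finset ℝ).card = 4 := by
    simp [hab, hac, had, hbc, hbd, hcd]
  rw [zeroResidue, hcard, Finset.prod_insert (by simp [hab, hac, had]),
    Finset.prod_insert (by simp [hbc, hbd]), Finset.prod_pair hcd]
  simp only [coeff_rescale_exp_mul, coeff_toddSeries_mul, coeff_toddSeries, Finset.sum_range_succ,
    Finset.sum_range_zero, Nat.reduceSub, bernoulli'_zero, bernoulli'_one, bernoulli'_two,
    bernoulli'_three, bernoulli'_four, Nat.factorial, polyPart]
  push_cast
  field_simp
  ring

lemma tendsto_totalResidue_of_subset (hB : Incommensurable B) (hAB : A ⊆ B) (hA : A.Nonempty)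
    (hL : 0 ≤ L) : Tendsto (totalResidue A L) (poleAvoiding B) (𝓝 (weightedCount A L)) := by
  have hA' : Incommensurable A := hB.mono hAB
  have hsum : 0 < ∑ a ∈ A, a := Finset.sum_pos hA'.pos hA
  exact (tendsto_totalResidue hA' (by linarith)).mono_left (poleAvoiding_anti hAB)

lemma tendsto_sawSum (hA : Incommensurable A) (ha : a ∈ A) (hL : 0 ≤ L) :
    Tendsto (sawSum a L) (poleAvoiding A) (𝓝 (-π * bernoulliStar (L / a))) := by
  have ha0 : 0 < a := hA.pos a ha
  have hlim := tendsto_totalResidue_of_subset hA (Finset.singleton_subset_iff.2 ha)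
    (Finset.singleton_nonempty a) hL
  convert! (hlim.sub_const (zeroResidue {a} L)).const_mul π using 2 with R
  · rw [totalResidue_singleton ha0]
    field_simp
    ring
  · rw [weightedCount_singleton ha0 (by linarith), zeroResidue_singleton ha0.ne']
    ring

lemma exists_tendsto_logPairTotal (hA : Incommensurable A) (ha : a ∈ A) (hb : b ∈ A)
    (hab : a ≠ b) (hL : 0 ≤ L) :
    ∃ l, Tendsto (logPairTotal a b L) (poleAvoiding A) (𝓝 l) := by
  have hsub : {a, b} ⊆ A := by grind
  have hlim := tendsto_totalResidue_of_subset hA hsub (Finset.insert_nonempty a {b}) hL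
  have hsaw := (tendsto_sawSum hA ha hL).add (tendsto_sawSum hA hb hL)
  refine ⟨_, ((hsaw.const_mul 2).sub
    ((hlim.sub_const (zeroResidue {a, b} L)).const_mul (2 * π))).congr fun R => ?_⟩
  rw [totalResidue_pair (hA.mono hsub) hab]
  field_simp
  ring

lemma exists_tendsto_logSineTotal (hA : Incommensurable A) (ha : a ∈ A) (hb : b ∈ A) (hc : c ∈ A)
    (h : [a, b, c].Nodup) (hL : 0 ≤ L) :
    ∃ l, Tendsto (logSineTotal a b c L) (poleAvoiding A) (𝓝 l) := by
  obtain ⟨⟨hab, hac⟩, hbc⟩ : (a ≠ b ∧ a ≠ c) ∧ b ≠ c := by simpa using h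
  have hsub : {a, b, c} ⊆ A := by grind
  have hlim := tendsto_totalResidue_of_subset hA hsub (Finset.insert_nonempty a {b, c}) hL
  have hsaw := ((tendsto_sawSum hA ha hL).add (tendsto_sawSum hA hb hL)).add
    (tendsto_sawSum hA hc hL)
  obtain ⟨_, hPab⟩ := exists_tendsto_logPairTotal hA ha hb hab hL
  obtain ⟨_, hPac⟩ := exists_tendsto_logPairTotal hA ha hc hac hL
  obtain ⟨_, hPbc⟩ := exists_tendsto_logPairTotal hA hb hc hbc hL
  refine ⟨_, (((hsaw.const_mul 4).sub ((hPab.add hPac).add hPbc)).sub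
    ((hlim.sub_const (zeroResidue {a, b, c} L)).const_mul (4 * π))).const_mul 2
    |>.congr fun R => ?_⟩
  rw [totalResidue_triple (hA.mono hsub) h]
  field_simp
  ring

theorem exists_tendsto_and_weightedCount_quadruple_eq (hA : Incommensurable {a, b, c, d})
    (h : [a, b, c, d].Nodup) (hL : 0 ≤ L) :
    ∃ Pab Pac Pad Pbc Pbd Pcd Tabc Tabd Tacd Tbcd Q : ℝ,
      Tendsto (logPairTotal a b L) (poleAvoiding {a, b, c, d}) (𝓝 Pab) ∧
      Tendsto (logPairTotal a c L) (poleAvoiding {a, b, c, d}) (𝓝 Pac) ∧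
      Tendsto (logPairTotal a d L) (poleAvoiding {a, b, c, d}) (𝓝 Pad) ∧
      Tendsto (logPairTotal b c L) (poleAvoiding {a, b, c, d}) (𝓝 Pbc) ∧
      Tendsto (logPairTotal b d L) (poleAvoiding {a, b, c, d}) (𝓝 Pbd) ∧
      Tendsto (logPairTotal c d L) (poleAvoiding {a, b, c, d}) (𝓝 Pcd) ∧
      Tendsto (logSineTotal a b c L) (poleAvoiding {a, b, c, d}) (𝓝 Tabc) ∧
      Tendsto (logSineTotal a b d L) (poleAvoiding {a, b, c, d}) (𝓝 Tabd) ∧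
      Tendsto (logSineTotal a c d L) (poleAvoiding {a, b, c, d}) (𝓝 Tacd) ∧
      Tendsto (logSineTotal b c d L) (poleAvoiding {a, b, c, d}) (𝓝 Tbcd) ∧
      Tendsto (logCosineTotal a b c d L) (poleAvoiding {a, b, c, d}) (𝓝 Q) ∧
      weightedCount {a, b, c, d} L = polyPart a b c d L
        - 7 / 8 * (bernoulliStar (L / a) + bernoulliStar (L / b) + bernoulliStar (L / c)
          + bernoulliStar (L / d))
        - 1 / (8 * π) * (Pab + Pac + Pad + Pbc + Pbd + Pcd)
        - 1 / (16 * π) * (Tabc + Tabd + Tacd + Tbcd) + 1 / (8 * π) * Q := by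
  obtain ⟨⟨hab, hac, had⟩, ⟨hbc, hbd⟩, hcd⟩ :
      (a ≠ b ∧ a ≠ c ∧ a ≠ d) ∧ (b ≠ c ∧ b ≠ d) ∧ c ≠ d := by simpa using h
  obtain ⟨ha, hb, hc, hd⟩ : a ∈ ({a, b, c, d} : Finset ℝ) ∧ b ∈ ({a, b, c, d} : Finset ℝ)
    ∧ c ∈ ({a, b, c, d} : Finset ℝ) ∧ d ∈ ({a, b, c, d} : Finset ℝ) := by simp
  obtain ⟨Pab, hPab⟩ := exists_tendsto_logPairTotal hA ha hb hab hL
  obtain ⟨Pac, hPac⟩ := exists_tendsto_logPairTotal hA ha hc hac hL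
  obtain ⟨Pad, hPad⟩ := exists_tendsto_logPairTotal hA ha hd had hL
  obtain ⟨Pbc, hPbc⟩ := exists_tendsto_logPairTotal hA hb hc hbc hL
  obtain ⟨Pbd, hPbd⟩ := exists_tendsto_logPairTotal hA hb hd hbd hL
  obtain ⟨Pcd, hPcd⟩ := exists_tendsto_logPairTotal hA hc hd hcd hL
  obtain ⟨Tabc, hTabc⟩ := exists_tendsto_logSineTotal hA ha hb hc (by simp [*]) hL
  obtain ⟨Tabd, hTabd⟩ := exists_tendsto_logSineTotal hA ha hb hd (by simp [*]) hL
  obtain ⟨Tacd, hTacd⟩ := exists_tendsto_logSineTotal hA ha hc hd (by simp [*]) hL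
  obtain ⟨Tbcd, hTbcd⟩ := exists_tendsto_logSineTotal hA hb hc hd (by simp [*]) hL
  have hsaw := (((tendsto_sawSum hA ha hL).add (tendsto_sawSum hA hb hL)).add
    (tendsto_sawSum hA hc hL)).add (tendsto_sawSum hA hd hL)
  have hP := ((((hPab.add hPac).add hPad).add hPbc).add hPbd).add hPcd
  have hT := ((hTabc.add hTabd).add hTacd).add hTbcd
  have hlim := tendsto_totalResidue_of_subset hA subset_rfl (Finset.insert_nonempty _ _) hL
  have hQ := ((((hlim.sub_const (polyPart a b c d L)).const_mul (8 * π)).sub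
    (hsaw.const_mul 7)).add (hT.const_mul (1 / 2))).add hP
  refine ⟨Pab, Pac, Pad, Pbc, Pbd, Pcd, Tabc, Tabd, Tacd, Tbcd, _, hPab, hPac, hPad, hPbc, hPbd,
    hPcd, hTabc, hTabd, hTacd, hTbcd, hQ.congr fun R => ?_, ?_⟩
  · rw [totalResidue_quadruple hA h, zeroResidue_quadruple (fun p hp => (hA.pos p hp).ne') h]
    field_simp
    ring
  · field_simp
    ring

end Limits

section SmoothNumberLimits

variable {F : ℝ → ℝ} {l δ : ℝ}

lemma admissible_eq : admissible δ
    = atTop ⊓ 𝓟 (avoiding {Real.log 2, Real.log 3, Real.log 5, Real.log 7} δ) := by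
  simp [admissible, avoiding]

lemma exists_neBot_admissible : ∃ δ : ℝ, 0 < δ ∧ (admissible δ).NeBot := by
  simpa only [admissible_eq] using exists_neBot_avoiding incommensurable_logs.pos

lemma appropriateLimit_iff : AppropriateLimit F l
    ↔ Tendsto F (poleAvoiding {Real.log 2, Real.log 3, Real.log 5, Real.log 7}) (𝓝 l) := by
  simp only [AppropriateLimit, admissible_eq, tendsto_poleAvoiding, gt_iff_lt]

end SmoothNumberLimits

theorem corollary10 :
    (∃ δ : ℝ, 0 < δ ∧ (admissible δ).NeBot) ∧
    ∀ x : ℝ, 1 ≤ x →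
      ∃ P₂₃ P₂₅ P₂₇ P₃₅ P₃₇ P₅₇ T₂₃₅ T₂₃₇ T₂₅₇ T₃₅₇ Q : ℝ,
        AppropriateLimit (pairSum 2 3 x) P₂₃ ∧
        AppropriateLimit (pairSum 2 5 x) P₂₅ ∧
        AppropriateLimit (pairSum 2 7 x) P₂₇ ∧
        AppropriateLimit (pairSum 3 5 x) P₃₅ ∧
        AppropriateLimit (pairSum 3 7 x) P₃₇ ∧
        AppropriateLimit (pairSum 5 7 x) P₅₇ ∧
        AppropriateLimit
          (fun R => sineSum 2 3 5 x R + sineSum 3 2 5 x R + sineSum 5 2 3 x R) T₂₃₅ ∧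
        AppropriateLimit
          (fun R => sineSum 2 3 7 x R + sineSum 3 2 7 x R + sineSum 7 2 3 x R) T₂₃₇ ∧
        AppropriateLimit
          (fun R => sineSum 2 5 7 x R + sineSum 5 2 7 x R + sineSum 7 2 5 x R) T₂₅₇ ∧
        AppropriateLimit
          (fun R => sineSum 3 5 7 x R + sineSum 5 3 7 x R + sineSum 7 3 5 x R) T₃₅₇ ∧
        AppropriateLimit
          (fun R => cosineSum 2 3 5 7 x R + cosineSum 3 2 5 7 x R
            + cosineSum 5 2 3 7 x R + cosineSum 7 2 3 5 x R) Q ∧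
        (sevenSmoothCount x : ℝ) =
          polyPart (Real.log 2) (Real.log 3) (Real.log 5) (Real.log 7) (Real.log x)
          - 7 / 8 * bernoulliStar (Real.log x / Real.log 2)
          - 7 / 8 * bernoulliStar (Real.log x / Real.log 3)
          - 7 / 8 * bernoulliStar (Real.log x / Real.log 5)
          - 7 / 8 * bernoulliStar (Real.log x / Real.log 7)
          - 1 / (8 * Real.pi) * P₂₃ - 1 / (8 * Real.pi) * P₂₅ - 1 / (8 * Real.pi) * P₂₇
          - 1 / (8 * Real.pi) * P₃₅ - 1 / (8 * Real.pi) * P₃₇ - 1 / (8 * Real.pi) * P₅₇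
          - 1 / (16 * Real.pi) * T₂₃₅ - 1 / (16 * Real.pi) * T₂₃₇
          - 1 / (16 * Real.pi) * T₂₅₇ - 1 / (16 * Real.pi) * T₃₅₇
          + 1 / (8 * Real.pi) * Q
          + 1 / 2 * sevenSmoothChar x := by
  refine ⟨exists_neBot_admissible, fun x hx => ?_⟩
  obtain ⟨P₂₃, P₂₅, P₂₇, P₃₅, P₃₇, P₅₇, T₂₃₅, T₂₃₇, T₂₅₇, T₃₅₇, Q, hP₂₃, hP₂₅, hP₂₇, hP₃₅, hP₃₇,
    hP₅₇, hT₂₃₅, hT₂₃₇, hT₂₅₇, hT₃₅₇, hQ, h⟩ := exists_tendsto_and_weightedCount_quadruple_eq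
      incommensurable_logs nodup_logs (Real.log_nonneg hx)
  simp only [appropriateLimit_iff]
  refine ⟨P₂₃, P₂₅, P₂₇, P₃₅, P₃₇, P₅₇, T₂₃₅, T₂₃₇, T₂₅₇, T₃₅₇, Q, hP₂₃, hP₂₅, hP₂₇, hP₃₅, hP₃₇,
    hP₅₇, hT₂₃₅, hT₂₃₇, hT₂₅₇, hT₃₅₇, hQ, ?_⟩
  linear_combination h - weightedCount_logs (zero_lt_one.trans_le hx)
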